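/- Let $\mathcal U=\langle S;P_1,\dots,P_r;L_1,\dots,L_r\rangle$, where $S$ is a countable (possibly empty) set of nonnegative real numbers, $P_1,\dots,P_r$ ($r\ge 0$) are relation symbols, $P_i$ of arity $k_i\geq 1$, and $L_i$ is a subgroup of the symmetric group of $\{1,\dots,k_i\}$. Consider the relational language consisting of a binary symbol $E_s$ for every $s\in S$ and the symbols $P_1,\dots,P_r$. A structure $\mathbf X$ in this language is called a $\mathcal U$-structure if 1. each $P_i^{\mathbf X}$ is $L_i$-symmetric, i.e. $P_i^{\mathbf X}(x_{\vartheta(1)},\dots,x_{\vartheta(k_i)})\Leftrightarrow P_i^{\mathbf X}(x_1,\dots,x_{k_i})$ for all $\vartheta\in L_i$; 2. $P_i^{\mathbf X}(x_1,\dots,x_{k_i})$ implies that $x_1,\dots,x_{k_i}$ are distinct; 3. each $E_s^{\mathbf X}$ is an equivalence relation; 4. $E_s^{\mathbf X}\subseteq E_t^{\mathbf X}$ whenever $s<t$ in $S$; 5. if $S\ne\emptyset$, then for all $x\neq y$ in $\mathbf X$ there is a greatest $s\in S$ such that $x$ and $y$ are not $E_s^{\mathbf X}$-equivalent. Let $\mathbf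 U$ be the randomised ultrametric space corresponding to $\mathcal U$, i.e. the (unique up to isomorphism) countable ultrahomogeneous structure in this language whose age is the class of all finite $\mathcal U$-structures. Equip its automorphism group $\mathrm{Aut}(\mathbf U)$ with the topology of pointwise convergence, $\mathbf U$ being discrete, and call $g\in\mathrm{Aut}(\mathbf U)$ generic if its conjugacy class is comeagre in $\mathrm{Aut}(\mathbf U)$. Then there is a generic automorphism of $\mathbf U$, and every generic automorphism $g$ of $\mathbf U$ has roots of all orders: for every integer $n\ge 1$ there is $h\in\mathrm{Aut}(\mathbf U)$ with $h^n=g$. Moreover, if $g$ is generic, then $g$ is conjugate to $g^n$ in $\mathrm{Aut}(\mathbf U)$ for every integer $n\neq 0$. -/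

import Mathlib

open scoped FirstOrder

universe u v w

/-- A tuple `⟨S; P₁, …, P_r; L₁, …, L_r⟩`: a countable set `S` of nonnegative reals, finitely many
relation symbols `P_i` of positive arity, and for each `i` a group `L_i` of permutations of the
argument places of `P_i`. -/
structure UltrametricData where
  S : Set ℝ
  nonneg : ∀ s ∈ S, 0 ≤ s
  countable : S.Countable
  r : ℕ
  arity : Fin r → ℕ
  arity_pos : ∀ i, 0 < arity i
  sym : ∀ i, Subgroup (Equiv.Perm (Fin (arity i)))

namespace UltrametricData

/-- The relation symbols: a binary symbol `E_s` for each `s ∈ S`, and the symbols `P_i`. -/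
inductive Rel (D : UltrametricData) : ℕ → Type
  | E (s : D.S) : Rel D 2
  | P (i : Fin D.r) : Rel D (D.arity i)

/-- The relational language with symbols `E_s` (`s ∈ S`) and `P_1, …, P_r`. -/
def lang (D : UltrametricData) : FirstOrder.Language.{0, 0} where
  Functions _ := Empty
  Relations := D.Rel

instance (D : UltrametricData) : D.lang.IsRelational := 
  fun _ => (inferInstance : IsEmpty Empty)

section
variable (D : UltrametricData) (X : Type*) [D.lang.Structure X]

/-- The interpretation of `E_s`. -/
def relE (s : D.S) (x y : X) : Prop :=
  FirstOrder.Language.Structure.RelMap (L := D.lang) (M := X) (Rel.E s : D.Rel 2) ![x, y]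

/-- The interpretation of `P_i`. -/
def relP (i : Fin D.r) (x : Fin (D.arity i) → X) : Prop :=
  FirstOrder.Language.Structure.RelMap (L := D.lang) (M := X) (Rel.P i : D.Rel (D.arity i)) x

/-- The structures of the class attached to `D`. For `S = ∅` there are no relations `E_s`, and the
separation condition is void. -/
structure IsUStructure : Prop where
  symmetric : ∀ (i : Fin D.r), ∀ θ ∈ D.sym i, ∀ x : Fin (D.arity i) → X,
    relP D X i (x ∘ θ) ↔ relP D X i x
  distinct : ∀ (i : Fin D.r) (x : Fin (D.arity i) → X), relP D X i x → Function.Injective x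
  equivalence : ∀ s : D.S, Equivalence (relE D X s)
  nested : ∀ s t : D.S, s < t → ∀ x y : X, relE D X s x y → relE D X t x y
  separated : D.S.Nonempty → ∀ x y : X, x ≠ y → ∃ s : D.S, IsGreatest {t : D.S | ¬ relE D X t x y} s

end

/-- The class of finite structures attached to `D`. -/
def finiteClass (D : UltrametricData) : Set (CategoryTheory.Bundled.{w} D.lang.Structure) :=
  {X | Finite X ∧ IsUStructure D X}

/-- `U` is (a copy of) the randomised ultrametric space corresponding to `D`: the countable
ultrahomogeneous structure whose age is the class of all finite structures attached to `D`. -/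
def IsRandomisedUltrametricSpace (D : UltrametricData) (U : Type w) [D.lang.Structure U]
    [Countable U] : Prop :=
  FirstOrder.Language.IsFraisseLimit D.finiteClass U

end UltrametricData

section
variable (L : FirstOrder.Language.{u, v}) (M : Type w) [L.Structure M]

/-- The automorphism group of a first-order structure, under composition. -/
instance autGroup : Group (M ≃[L] M) where
  mul g h := g.comp h
  one := FirstOrder.Language.Equiv.refl L M
  inv g := g.symm
  mul_assoc _ _ _ := rfl
  one_mul _ := rfl
  mul_one _ := rfl
  inv_mul_cancel g := FirstOrder.Language.Equiv.ext fun x => g.symm_apply_apply x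

/-- The topology of pointwise convergence on the automorphism group, the structure being
discrete. -/
instance autTopology : TopologicalSpace (M ≃[L] M) :=
  TopologicalSpace.induced (fun g : M ≃[L] M => (g : M → M))
    (@Pi.topologicalSpace M (fun _ => M) (fun _ => ⊥))

variable {L M}

/-- An automorphism is generic if its conjugacy class is comeagre in the automorphism group. -/
def IsGenericAut (g : M ≃[L] M) : Prop :=
  {h : M ≃[L] M | IsConj g h} ∈ residual (M ≃[L] M)

end

/-! Call an automorphism homogeneous if every finite set lies in a finite invariant set and every
finite extension of its action on a finite invariant set is realised over that set; it is then a
Fraïssé limit of finite structures with an automorphism. By back-and-forth any two homogeneous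
automorphisms are conjugate (`IsHomogeneousAut.isConj`). Two properties of the structure make them
comeagre: `HasFiniteExtensions`, the extension property for partial automorphisms, and
`HasEquivariantAmalgams`. So the generic automorphisms are exactly the homogeneous ones.

Inverses and positive powers of a homogeneous `g` are again homogeneous, hence conjugate to `g`;
conjugating `g` itself then yields roots. The crux for powers is `HasEquivariantAmalgams.root`: if
`h` on `B` extends `g ^ n` on `A`, amalgamate `n` copies of `B` over `A` and permute them
cyclically, twisting by `h` once per turn; the `n`-th power of this map is `h` on the original copy.

For the ultrametric space, the `E_s` are encoded by an ultrametric. Copies are amalgamated by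
measuring distances through `A` and adding no relations across copies (`exists_amalgam`). A partial
automorphism is extended first as an isometry, in a product indexed by the distances
(`exists_isometry_extension`), then made to respect the `P_i` by attaching bits to the points and
reading the relations off as parities (`exists_relation_extension`). -/

namespace FirstOrder.Language.Equiv

section Aut

variable {L : FirstOrder.Language.{u, v}} {M : Type w} [L.Structure M]

/-! ### Automorphisms and their finite invariant sets -/

theorem aut_mul_apply (g h : M ≃[L] M) (x : M) : (g * h) x = g (h x) := rfl

theorem aut_one_apply (x : M) : (1 : M ≃[L] M) x = x := rfl

theorem aut_inv_apply_self (g : M ≃[L] M) (x : M) : g⁻¹ (g x) = x := g.symm_apply_apply x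

theorem aut_apply_inv_self (g : M ≃[L] M) (x : M) : g (g⁻¹ x) = x := g.apply_symm_apply x

theorem aut_inv_eq_iff (g : M ≃[L] M) {x y : M} : g⁻¹ x = y ↔ x = g y := by
  constructor
  · rintro rfl
    exact (aut_apply_inv_self g x).symm
  · rintro rfl
    exact aut_inv_apply_self g y

/-- The set `A` is invariant under `g`. -/
def Inv (g : M → M) (A : Finset M) : Prop := ∀ x, g x ∈ A ↔ x ∈ A

theorem Inv.of_forall {g : M → M} (hg : Function.Injective g) {A : Finset M}
    (h : ∀ x ∈ A, g x ∈ A) : Inv g A := by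
  classical
  intro x
  refine ⟨fun hx => ?_, h x⟩
  have himg : A.image g = A :=
    Finset.eq_of_subset_of_card_le (Finset.image_subset_iff.2 h)
      (Finset.card_image_of_injective A hg).ge
  rw [← himg, Finset.mem_image] at hx
  obtain ⟨y, hy, hyx⟩ := hx
  exact hg hyx ▸ hy

theorem Inv.mul {g h : M ≃[L] M} {A : Finset M} (hg : Inv g A) (hh : Inv h A) :
    Inv (g * h : M ≃[L] M) A := fun x => (hg (h x)).trans (hh x)

theorem Inv.inv {g : M ≃[L] M} {A : Finset M} (hg : Inv g A) : Inv (g⁻¹ : M ≃[L] M) A := fun x => by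
  rw [← hg (g⁻¹ x), aut_apply_inv_self]

theorem Inv.pow {g : M ≃[L] M} {A : Finset M} (hg : Inv g A) (n : ℕ) :
    Inv (g ^ n : M ≃[L] M) A := by
  induction n with
  | zero => exact fun x => by rw [pow_zero, aut_one_apply]
  | succ n ih => rw [pow_succ]; exact ih.mul hg

theorem Inv.congr {g h : M → M} {A : Finset M} (hh : Function.Injective h) (hg : Inv g A)
    (e : ∀ x ∈ A, h x = g x) : Inv h A :=
  Inv.of_forall hh fun x hx => by rw [e x hx]; exact (hg x).2 hx

/-! ### The topology of pointwise convergence -/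

theorem isOpen_setOf_aut_apply_mem (x : M) (s : Set M) : IsOpen {g : M ≃[L] M | g x ∈ s} := by
  let _ : TopologicalSpace M := ⊥
  have _ : DiscreteTopology M := ⟨rfl⟩
  have h : Continuous fun g : M ≃[L] M => (g : M → M) := continuous_induced_dom
  exact (isOpen_discrete s).preimage ((continuous_apply x).comp h)

theorem exists_finset_forall_mem_of_isOpen {O : Set (M ≃[L] M)} (hO : IsOpen O) {g : M ≃[L] M}
    (hg : g ∈ O) : ∃ F : Finset M, ∀ h : M ≃[L] M, (∀ x ∈ F, h x = g x) → h ∈ O := by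
  let _ : TopologicalSpace M := ⊥
  obtain ⟨V, hV, rfl⟩ := isOpen_induced_iff.1 hO
  obtain ⟨F, u, hu, hF⟩ := isOpen_pi_iff.1 hV _ hg
  exact ⟨F, fun h hh => hF fun x hx => by simpa only [hh x hx] using (hu x hx).2⟩

/-- A pair of mutually inverse pointwise limits of automorphisms is an automorphism. -/
theorem exists_aut_of_forall_finset (φ ψ : M → M) (h : ∀ F : Finset M, ∃ g : M ≃[L] M,
    (∀ x ∈ F, g x = φ x) ∧ ∀ x ∈ F, g⁻¹ x = ψ x) :
    ∃ g : M ≃[L] M, (∀ x, g x = φ x) ∧ ∀ x, g⁻¹ x = ψ x := by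
  classical
  refine ⟨⟨⟨φ, ψ, fun x => ?_, fun x => ?_⟩, fun {n} f x => ?_, fun {n} r x => ?_⟩,
    fun _ => rfl, fun _ => rfl⟩
  · obtain ⟨g, h1, h2⟩ := h {x, φ x}
    rw [← h2 _ (by simp), ← h1 x (by simp), aut_inv_apply_self]
  · obtain ⟨g, h1, h2⟩ := h {x, ψ x}
    rw [← h1 _ (by simp), ← h2 x (by simp), aut_apply_inv_self]
  · obtain ⟨g, h1, h2⟩ := h (insert (Structure.funMap f x) (Finset.univ.image x))
    have e : φ ∘ x = g ∘ x := funext fun i => (h1 _ (by simp)).symm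
    change φ _ = Structure.funMap f (φ ∘ x)
    rw [e, ← h1 _ (by simp), g.map_fun]
  · obtain ⟨g, h1, h2⟩ := h (Finset.univ.image x)
    have e : φ ∘ x = g ∘ x := funext fun i => (h1 _ (by simp)).symm
    change Structure.RelMap r (φ ∘ x) ↔ _
    rw [e, g.map_rel]

/-- The map `g ↦ (g, g⁻¹)` has closed image in a Polish space. Recording the inverse matters: a
pointwise limit of automorphisms alone need not be surjective. -/
instance baireSpace_aut [Countable M] : BaireSpace (M ≃[L] M) := by
  classical
  let _ : TopologicalSpace M := ⊥
  have _ : DiscreteTopology M := ⟨rfl⟩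
  let F : (M ≃[L] M) → (M → M) × (M → M) := fun g => (g, (g⁻¹ : M ≃[L] M))
  have hcont : Continuous fun g : M ≃[L] M => (g : M → M) := continuous_induced_dom
  have hinv : Continuous fun g : M ≃[L] M => ((g⁻¹ : M ≃[L] M) : M → M) := by
    refine continuous_pi fun x => continuous_def.2 fun s _ => ?_
    have : (fun g : M ≃[L] M => (g⁻¹ : M ≃[L] M) x) ⁻¹' s = ⋃ y ∈ s, {g | g y ∈ ({x} : Set M)} := by
      ext g
      simp only [Set.mem_preimage, Set.mem_iUnion, Set.mem_ofPred_eq, Set.mem_singleton_iff,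
        exists_prop]
      constructor
      · exact fun h => ⟨_, h, aut_apply_inv_self g x⟩
      · rintro ⟨y, hy, rfl⟩
        rwa [aut_inv_apply_self]
    rw [this]
    exact isOpen_biUnion fun y _ => isOpen_setOf_aut_apply_mem y _
  have hF : Continuous F := hcont.prodMk hinv
  have hind : Topology.IsInducing F :=
    Topology.IsInducing.of_comp hF continuous_fst ⟨rfl⟩
  have hinj : Function.Injective F := fun g h e => by
    have : (g : M → M) = h := congrArg Prod.fst e
    exact FirstOrder.Language.Equiv.ext fun x => congrFun this x
  have hev₁ : ∀ x, Continuous fun q : (M → M) × (M → M) => q.1 x := fun x => by fun_prop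
  have hev₂ : ∀ x, Continuous fun q : (M → M) × (M → M) => q.2 x := fun x => by fun_prop
  have hclosed : IsClosed (Set.range F) := by
    refine isClosed_of_closure_subset fun p hp => ?_
    have key := fun E : Finset M => mem_closure_iff.1 hp
      ({q | ∀ x ∈ E, q.1 x = p.1 x} ∩ {q | ∀ x ∈ E, q.2 x = p.2 x})
      (by
        refine IsOpen.inter ?_ ?_
        · simp only [Set.ofPred_forall]
          refine isOpen_biInter_finset fun x _ => ?_
          exact (isOpen_discrete ({p.1 x} : Set M)).preimage (hev₁ x)
        · simp only [Set.ofPred_forall]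
          refine isOpen_biInter_finset fun x _ => ?_
          exact (isOpen_discrete ({p.2 x} : Set M)).preimage (hev₂ x))
      ⟨fun _ _ => rfl, fun _ _ => rfl⟩
    obtain ⟨g, h1, h2⟩ := exists_aut_of_forall_finset (L := L) p.1 p.2 fun E => by
      obtain ⟨_, ⟨h1, h2⟩, g, rfl⟩ := key E
      exact ⟨g, h1, h2⟩
    exact ⟨g, Prod.ext (funext h1) (funext h2)⟩
  have hemb : Topology.IsClosedEmbedding F := ⟨⟨hind, hinj⟩, hclosed⟩
  have hM : PolishSpace M := inferInstance
  have := hemb.polishSpace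
  infer_instance

/-! ### Homogeneous automorphisms -/

/-- Every finite set lies in a finite invariant set, and every finite extension, by an
automorphism, of the action on a finite invariant set is realised over that set. -/
structure IsHomogeneousAut (g : M ≃[L] M) : Prop where
  locallyFinite : ∀ F : Finset M, ∃ C : Finset M, F ⊆ C ∧ Inv g C
  extension : ∀ (A B : Finset M) (h : M ≃[L] M), A ⊆ B → Inv g A → Inv h B →
    (∀ a ∈ A, h a = g a) →
    ∃ f : M ≃[L] M, (∀ a ∈ A, f a = a) ∧ ∀ b ∈ B, g (f b) = f (h b)

variable (L M) in
/-- Every finite restriction of an automorphism extends to an automorphism with a finite invariant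
set that contains the given finite set. -/
def HasFiniteExtensions : Prop :=
  ∀ (F : Finset M) (g : M ≃[L] M), ∃ (g' : M ≃[L] M) (C : Finset M),
    (∀ x ∈ F, g' x = g x) ∧ F ⊆ C ∧ Inv g' C

variable (L M) in
/-- Finite sets over a common subset can be amalgamated compatibly with partial automorphisms that
permute them. -/
def HasEquivariantAmalgams : Prop :=
  ∀ (n : ℕ) (π : Fin n → Fin n) (A : Finset M) (B : Fin n → Finset M) (β : Fin n → (M ≃[L] M)),
    Function.Injective π → (∀ i, A ⊆ B i) → (∀ i b, β i b ∈ B (π i) ↔ b ∈ B i) →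
    (∀ i, Inv (β i) A) → (∀ i j, ∀ a ∈ A, β i a = β j a) →
    ∃ (g : M ≃[L] M) (f : Fin n → (M ≃[L] M)), (∀ i j, ∀ a ∈ A, f i a = f j a) ∧
      ∀ i, ∀ b ∈ B i, g (f i b) = f (π i) (β i b)

/-- Conjugating by `f 0` puts the copy of index `0` back in its original place; all copies of `A`
then stay in place too. -/
theorem HasEquivariantAmalgams.normalized (H : HasEquivariantAmalgams L M) {n : ℕ}
    (π : Fin (n + 1) → Fin (n + 1)) (A : Finset M) (B : Fin (n + 1) → Finset M)
    (β : Fin (n + 1) → (M ≃[L] M)) (hπ : Function.Injective π) (hAB : ∀ i, A ⊆ B i)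
    (hB : ∀ i b, β i b ∈ B (π i) ↔ b ∈ B i) (hA : ∀ i, Inv (β i) A)
    (hβ : ∀ i j, ∀ a ∈ A, β i a = β j a) :
    ∃ (g : M ≃[L] M) (f : Fin (n + 1) → (M ≃[L] M)), f 0 = 1 ∧ (∀ i, ∀ a ∈ A, f i a = a) ∧
      ∀ i, ∀ b ∈ B i, g (f i b) = f (π i) (β i b) := by
  obtain ⟨g, f, h1, h2⟩ := H (n + 1) π A B β hπ hAB hB hA hβ
  refine ⟨(f 0)⁻¹ * g * f 0, fun i => (f 0)⁻¹ * f i, inv_mul_cancel _, fun i a ha => ?_,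
    fun i b hb => ?_⟩
  · rw [aut_mul_apply, aut_inv_eq_iff, h1 i 0 a ha]
  · rw [aut_mul_apply, aut_mul_apply, aut_mul_apply, aut_apply_inv_self, h2 i b hb,
      aut_mul_apply]

/-- Amalgamation of two finite automorphisms over a common restriction. -/
theorem HasEquivariantAmalgams.pair (H : HasEquivariantAmalgams L M) {A B C : Finset M}
    {g h : M ≃[L] M} (hAB : A ⊆ B) (hAC : A ⊆ C) (hA : Inv g A) (hB : Inv h B) (hC : Inv g C)
    (hgh : ∀ a ∈ A, h a = g a) :
    ∃ g' f : M ≃[L] M, (∀ c ∈ C, g' c = g c) ∧ (∀ a ∈ A, f a = a) ∧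
      ∀ b ∈ B, g' (f b) = f (h b) := by
  obtain ⟨g', f, h0, h1, h2⟩ := H.normalized (n := 1) id A ![C, B] ![g, h] Function.injective_id
    (by simp [Fin.forall_fin_two, hAB, hAC])
    (by simpa [Fin.forall_fin_two] using ⟨hC, hB⟩)
    (by simpa [Fin.forall_fin_two] using ⟨hA, hA.congr h.injective hgh⟩)
    (Fin.forall_fin_two.2 ⟨Fin.forall_fin_two.2 ⟨fun _ _ => rfl, fun a ha => (hgh a ha).symm⟩,
      Fin.forall_fin_two.2 ⟨hgh, fun _ _ => rfl⟩⟩)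
  refine ⟨g', f 1, fun c hc => ?_, h1 1, fun b hb => ?_⟩
  · have := h2 0 c hc
    rwa [id, h0, aut_one_apply, aut_one_apply] at this
  · exact h2 1 b hb

/-- An extension of a power of a finite automorphism is the power of an extension. -/
theorem HasEquivariantAmalgams.root (H : HasEquivariantAmalgams L M) {A B : Finset M}
    {g h : M ≃[L] M} (m : ℕ) (hAB : A ⊆ B) (hA : Inv g A) (hB : Inv h B)
    (hgh : ∀ a ∈ A, h a = (g ^ (m + 1)) a) :
    ∃ (g' : M ≃[L] M) (C : Finset M), (∀ a ∈ A, g' a = g a) ∧ (∀ b ∈ B, (g' ^ (m + 1)) b = h b) ∧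
      B ⊆ C ∧ Inv g' C := by
  classical
  let Bi : Fin (m + 1) → Finset M := fun i => B.image (g ^ (i : ℕ))
  have mem_Bi : ∀ (i : Fin (m + 1)) (b : M), (g ^ (i : ℕ)) b ∈ Bi i ↔ b ∈ B := fun i b => by
    simp [Bi, (g ^ (i : ℕ)).injective.eq_iff]
  -- The `i`-th copy is `g ^ i` applied to `B`. Each step is `g`, except that the last is `h * (g ^
  -- m)⁻¹`, so a full turn is `h`. On `A` the last step is also `g`, because `h = g ^ (m + 1)`
  -- there.
  let β : Fin (m + 1) → (M ≃[L] M) := fun i => if i = Fin.last m then h * (g ^ m)⁻¹ else g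
  have hβA : ∀ i, ∀ a ∈ A, β i a = g a := fun i a ha => by
    by_cases hi : i = Fin.last m
    · simp only [β, if_pos hi, aut_mul_apply]
      rw [hgh _ (((hA.pow m).inv a).2 ha), pow_succ', aut_mul_apply, aut_apply_inv_self]
    · simp only [β, if_neg hi]
  obtain ⟨g', f, h0, h1, h2⟩ := H.normalized (fun i => i + 1) A Bi β (add_left_injective 1)
    (fun i a ha => by
      have : (g ^ (i : ℕ)) ((g ^ (i : ℕ))⁻¹ a) ∈ Bi i :=
        (mem_Bi i _).2 (hAB (((hA.pow i).inv a).2 ha))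
      rwa [aut_apply_inv_self] at this)
    (fun i b => by
      obtain ⟨b, rfl⟩ : ∃ c, (g ^ (i : ℕ)) c = b := ⟨_, aut_apply_inv_self _ b⟩
      rw [mem_Bi]
      by_cases hi : i = Fin.last m
      · subst hi
        simp only [β, if_pos, aut_mul_apply, Fin.last_add_one, Fin.val_last, aut_inv_apply_self]
        have := mem_Bi 0 (h b)
        rw [Fin.val_zero, pow_zero, aut_one_apply] at this
        rw [this, hB b]
      · simp only [β, if_neg hi]
        have hv : ((i + 1 : Fin (m + 1)) : ℕ) = i + 1 := by
          rw [Fin.val_add_one, if_neg hi]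
        rw [← aut_mul_apply, ← pow_succ', ← hv, mem_Bi])
    (fun i => hA.congr (β i).injective (hβA i))
    (fun i j a ha => by rw [hβA i a ha, hβA j a ha])
  have hpow : ∀ (i : ℕ) (hi : i < m + 1), ∀ b ∈ B, (g' ^ i) b = f ⟨i, hi⟩ ((g ^ i) b) := by
    intro i
    induction i with
    | zero =>
      intro hi b _
      have : (⟨0, hi⟩ : Fin (m + 1)) = 0 := rfl
      rw [this, h0, pow_zero, pow_zero, aut_one_apply, aut_one_apply]
    | succ i ih =>
      intro hi b hb
      have hi' : i < m + 1 := by omega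
      have hl : (⟨i, hi'⟩ : Fin (m + 1)) ≠ Fin.last m := fun e => by
        have := congrArg Fin.val e
        simp at this
        omega
      rw [pow_succ', aut_mul_apply, ih hi' b hb, h2 _ _ ((mem_Bi ⟨i, hi'⟩ b).2 hb)]
      have e : (⟨i, hi'⟩ : Fin (m + 1)) + 1 = ⟨i + 1, hi⟩ := by
        apply Fin.ext
        rw [Fin.val_add_one, if_neg hl]
      simp only [β, if_neg hl, e]
      rw [pow_succ' g, aut_mul_apply]
  refine ⟨g', Finset.univ.biUnion fun i => (Bi i).image (f i), fun a ha => ?_, fun b hb => ?_,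
    fun b hb => ?_, Inv.of_forall g'.injective ?_⟩
  · have hmem : a ∈ Bi 0 := by
      have := (mem_Bi 0 a).2 (hAB ha)
      rwa [Fin.val_zero, pow_zero, aut_one_apply] at this
    have := h2 0 a hmem
    rwa [h0, aut_one_apply, hβA 0 a ha, h1 _ _ ((hA a).2 ha)] at this
  · rw [pow_succ', aut_mul_apply, hpow m (Nat.lt_succ_self m) b hb]
    have := h2 (Fin.last m) _ ((mem_Bi (Fin.last m) b).2 hb)
    simp only [Fin.last_add_one, h0, β, if_true, Fin.val_last, aut_one_apply, aut_mul_apply,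
      aut_inv_apply_self] at this
    exact this
  · simp only [Finset.mem_biUnion, Finset.mem_univ, true_and, Finset.mem_image]
    refine ⟨0, b, ?_, by rw [h0, aut_one_apply]⟩
    have := (mem_Bi 0 b).2 hb
    rwa [Fin.val_zero, pow_zero, aut_one_apply] at this
  · simp only [Finset.mem_biUnion, Finset.mem_univ, true_and, Finset.mem_image]
    rintro _ ⟨i, b, hb, rfl⟩
    refine ⟨i + 1, β i b, ?_, (h2 i b hb).symm⟩
    obtain ⟨c, hc, rfl⟩ := Finset.mem_image.1 hb
    by_cases hi : i = Fin.last m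
    · subst hi
      simp only [β, if_pos, aut_mul_apply, Fin.last_add_one, Fin.val_last, aut_inv_apply_self]
      have := mem_Bi 0 (h c)
      rw [Fin.val_zero, pow_zero, aut_one_apply] at this
      exact this.2 ((hB c).2 hc)
    · simp only [β, if_neg hi]
      have hv : ((i + 1 : Fin (m + 1)) : ℕ) = i + 1 := by
        rw [Fin.val_add_one, if_neg hi]
      rw [← aut_mul_apply, ← pow_succ', ← hv, mem_Bi]
      exact hc

end Aut

end FirstOrder.Language.Equiv

/-! ### Homogeneous automorphisms: comeagreness, conjugacy, powers -/

namespace FirstOrder.Language.Equiv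

section Aut

variable {L : FirstOrder.Language.{u, v}} {M : Type w} [L.Structure M]

theorem Inv.aut_conj {g k : M ≃[L] M} {A A' : Finset M} (hg : Inv g A)
    (hA' : ∀ x, k x ∈ A' ↔ x ∈ A) : Inv (k * g * k⁻¹ : M ≃[L] M) A' := fun x => by
  obtain ⟨x, rfl⟩ : ∃ y, k y = x := ⟨_, aut_apply_inv_self k x⟩
  rw [aut_mul_apply, aut_mul_apply, aut_inv_apply_self, hA', hA', hg]

theorem dense_of_forall_finset {O : Set (M ≃[L] M)}
    (h : ∀ (F : Finset M) (g : M ≃[L] M), ∃ g' ∈ O, ∀ x ∈ F, g' x = g x) : Dense O := by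
  intro g
  refine mem_closure_iff.2 fun V hV hg => ?_
  obtain ⟨F, hF⟩ := exists_finset_forall_mem_of_isOpen hV hg
  obtain ⟨g', hg', e⟩ := h F g
  exact ⟨g', hF g' e, hg'⟩

theorem isOpen_setOf_inv (C : Finset M) : IsOpen {g : M ≃[L] M | Inv g C} := by
  have : {g : M ≃[L] M | Inv g C} = ⋂ x ∈ C, {g | g x ∈ (C : Set M)} := by
    ext g
    simp only [Set.mem_ofPred_eq, Set.mem_iInter]
    exact ⟨fun h x hx => (h x).2 hx, fun h => Inv.of_forall g.injective h⟩
  rw [this]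
  exact isOpen_biInter_finset fun x _ => isOpen_setOf_aut_apply_mem x _

theorem HasFiniteExtensions.eventually_exists_inv (H : HasFiniteExtensions L M) (F : Finset M) :
    {g : M ≃[L] M | ∃ C : Finset M, F ⊆ C ∧ Inv g C} ∈ residual (M ≃[L] M) := by
  classical
  refine residual_of_dense_open ?_ (dense_of_forall_finset fun E g => ?_)
  · simp only [Set.ofPred_exists, Set.ofPred_and]
    exact isOpen_iUnion fun C => isOpen_const.inter (isOpen_setOf_inv C)
  · obtain ⟨g', C, h1, h2, h3⟩ := H (E ∪ F) g
    exact ⟨g', ⟨C, Finset.union_subset_right h2, h3⟩, fun x hx => h1 x (Finset.mem_union_left _ hx)⟩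

/-- For density, a `g` that disagrees with `h` on `A` qualifies vacuously. Otherwise `g` is first
replaced by one with a finite invariant set `C` containing `F ∪ A`, and `h` on `B` is amalgamated
with it over `A`. -/
theorem eventually_extension (HF : HasFiniteExtensions L M) (HA : HasEquivariantAmalgams L M)
    {A B : Finset M} {h : M ≃[L] M} (hAB : A ⊆ B) (hA : Inv h A) (hB : Inv h B) :
    {g : M ≃[L] M | (∀ a ∈ A, h a = g a) →
      ∃ f : M ≃[L] M, (∀ a ∈ A, f a = a) ∧ ∀ b ∈ B, g (f b) = f (h b)} ∈
        residual (M ≃[L] M) := by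
  classical
  refine residual_of_dense_open ?_ (dense_of_forall_finset fun F g => ?_)
  · have : {g : M ≃[L] M | (∀ a ∈ A, h a = g a) →
      ∃ f : M ≃[L] M, (∀ a ∈ A, f a = a) ∧ ∀ b ∈ B, g (f b) = f (h b)} =
        (⋃ a ∈ A, {g | g a ∈ ({h a}ᶜ : Set M)}) ∪
        ⋃ f ∈ {f : M ≃[L] M | ∀ a ∈ A, f a = a}, ⋂ b ∈ B, {g | g (f b) ∈ ({f (h b)} : Set M)} := by
      ext g
      simp only [Set.mem_ofPred_eq, Set.mem_union, Set.mem_iUnion, Set.mem_iInter,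
        Set.mem_singleton_iff, Set.mem_compl_iff, exists_prop]
      rw [imp_iff_not_or]
      push Not
      simp only [ne_comm]
    rw [this]
    refine IsOpen.union (isOpen_biUnion fun a _ => isOpen_setOf_aut_apply_mem a _)
      (isOpen_biUnion fun f _ => isOpen_biInter_finset fun b _ => isOpen_setOf_aut_apply_mem _ _)
  · by_cases hg : ∀ a ∈ A, h a = g a
    · obtain ⟨g₁, C, h1, h2, h3⟩ := HF (F ∪ A) g
      have e : ∀ a ∈ A, h a = g₁ a := fun a ha => by
        rw [hg a ha, h1 a (Finset.mem_union_right _ ha)]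
      obtain ⟨g', f, k1, k2, k3⟩ := HA.pair hAB (Finset.union_subset_right h2)
        (hA.congr g₁.injective fun x hx => (e x hx).symm) hB h3 e
      exact ⟨g', fun _ => ⟨f, k2, k3⟩, fun x hx => by
        rw [k1 x (h2 (Finset.mem_union_left _ hx)), h1 x (Finset.mem_union_left _ hx)]⟩
    · exact ⟨g, fun hg' => absurd hg' hg, fun _ _ => rfl⟩

theorem isHomogeneousAut_mem_residual [Countable M] (HF : HasFiniteExtensions L M)
    (HA : HasEquivariantAmalgams L M) :
    {g : M ≃[L] M | IsHomogeneousAut g} ∈ residual (M ≃[L] M) := by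
  classical
  -- The extension property depends on `h` only through its restriction to `B`, so one
  -- representative per map `B → M` leaves countably many conditions. The value `1` is used where no
  -- automorphism induces the map.
  let s : (B : Finset M) → (B → M) → (M ≃[L] M) := fun B φ =>
    if h : ∃ k : M ≃[L] M, ∀ b : B, k b = φ b then h.choose else 1
  have hs : ∀ (B : Finset M) (k : M ≃[L] M), ∀ b ∈ B, s B (fun b => k b) b = k b := fun B k b hb => by
    have h : ∃ k' : M ≃[L] M, ∀ b : B, k' b = k b := ⟨k, fun _ => rfl⟩
    simp only [s, dif_pos h]
    exact h.choose_spec ⟨b, hb⟩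
  have h1 : ∀ᶠ g : M ≃[L] M in residual (M ≃[L] M), ∀ F : Finset M, ∃ C : Finset M, F ⊆ C ∧ Inv g C :=
    eventually_countable_forall.2 fun F => HF.eventually_exists_inv F
  have h2 : ∀ᶠ g : M ≃[L] M in residual (M ≃[L] M), ∀ (A : Finset M) (q : Σ B : Finset M, B → M),
      A ⊆ q.1 → Inv (s q.1 q.2) A → Inv (s q.1 q.2) q.1 → (∀ a ∈ A, s q.1 q.2 a = g a) →
      ∃ f : M ≃[L] M, (∀ a ∈ A, f a = a) ∧ ∀ b ∈ q.1, g (f b) = f (s q.1 q.2 b) := by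
    refine eventually_countable_forall.2 fun A => eventually_countable_forall.2 fun q => ?_
    by_cases hq : A ⊆ q.1 ∧ Inv (s q.1 q.2) A ∧ Inv (s q.1 q.2) q.1
    · filter_upwards [eventually_extension HF HA hq.1 hq.2.1 hq.2.2] with g hg _ _ _ using hg
    · exact Filter.Eventually.of_forall fun g a b c => absurd ⟨a, b, c⟩ hq
  filter_upwards [h1, h2] with g g1 g2
  refine ⟨g1, fun A B h hAB hgA hB e => ?_⟩
  have hsA : ∀ a ∈ A, s B (fun b => h b) a = g a := fun a ha => by rw [hs B h a (hAB ha), e a ha]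
  obtain ⟨f, k1, k2⟩ := g2 A ⟨B, fun b => h b⟩ hAB (hgA.congr (Equiv.injective _) hsA)
    (hB.congr (Equiv.injective _) (hs B h)) hsA
  exact ⟨f, k1, fun b hb => by rw [k2 b hb]; exact congrArg f (hs B h b hb)⟩

theorem IsHomogeneousAut.conj {g : M ≃[L] M} (hg : IsHomogeneousAut g) (k : M ≃[L] M) :
    IsHomogeneousAut (k * g * k⁻¹) := by
  classical
  have mem_im : ∀ (k : M ≃[L] M) (A : Finset M) (x : M), k x ∈ A.image k ↔ x ∈ A := fun k A x => by
    simp [k.injective.eq_iff]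
  have back : ∀ (k : M ≃[L] M) (A : Finset M), ∀ a ∈ A.image k, k⁻¹ a ∈ A := by
    intro k A a ha
    rwa [← mem_im k, aut_apply_inv_self]
  have e : k⁻¹ * (k * g * k⁻¹) * (k⁻¹)⁻¹ = g := by group
  constructor
  · intro F
    obtain ⟨C, hC, hgC⟩ := hg.locallyFinite (F.image (k⁻¹ : M ≃[L] M))
    refine ⟨C.image k, fun x hx => ?_, hgC.aut_conj (mem_im k C)⟩
    rw [← aut_apply_inv_self k x, mem_im]
    exact hC (Finset.mem_image_of_mem _ hx)
  · intro A B h hAB hA hB hh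
    have hA' := hA.aut_conj (mem_im k⁻¹ A)
    rw [e] at hA'
    obtain ⟨f, h1, h2⟩ := hg.extension _ _ (k⁻¹ * h * (k⁻¹)⁻¹) (Finset.image_subset_image hAB)
      hA' (hB.aut_conj (mem_im k⁻¹ B)) (fun a ha => by
        have := hh _ (back _ _ a ha)
        rw [inv_inv] at this ⊢
        rw [aut_mul_apply, aut_mul_apply, this, aut_mul_apply, aut_mul_apply, aut_inv_apply_self,
          aut_inv_apply_self])
    refine ⟨k * f * k⁻¹, fun a ha => ?_, fun b hb => ?_⟩
    · rw [aut_mul_apply, aut_mul_apply, h1 _ (Finset.mem_image_of_mem _ ha), aut_apply_inv_self]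
    · have := h2 _ (Finset.mem_image_of_mem _ hb)
      simp only [inv_inv, aut_mul_apply, aut_apply_inv_self, aut_inv_apply_self] at this ⊢
      rw [this]

/-- One step of the back-and-forth between two homogeneous automorphisms. -/
theorem IsHomogeneousAut.exists_extend_conj {g g' : M ≃[L] M} (hg : IsHomogeneousAut g)
    (hg' : IsHomogeneousAut g') {A : Finset M} {k : M ≃[L] M} (hA : Inv g A)
    (hk : ∀ a ∈ A, k (g a) = g' (k a)) (F : Finset M) :
    ∃ (C : Finset M) (k' : M ≃[L] M), A ⊆ C ∧ F ⊆ C ∧ Inv g C ∧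
      (∀ c ∈ C, k' (g c) = g' (k' c)) ∧ ∀ a ∈ A, k' a = k a := by
  classical
  obtain ⟨C, hC, hgC⟩ := hg.locallyFinite (A ∪ F)
  have hh := hg'.conj k⁻¹
  rw [inv_inv] at hh
  have e : ∀ a ∈ A, g a = (k⁻¹ * g' * k : M ≃[L] M) a := fun a ha => by
    rw [aut_mul_apply, aut_mul_apply, ← hk a ha, aut_inv_apply_self]
  obtain ⟨f, h1, h2⟩ := hh.extension A C g (Finset.union_subset_left hC)
    (hA.congr (Equiv.injective _) fun x hx => (e x hx).symm) hgC e
  refine ⟨C, k * f, Finset.union_subset_left hC, Finset.union_subset_right hC, hgC,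
    fun c hc => ?_, fun a ha => by rw [aut_mul_apply, h1 a ha]⟩
  rw [aut_mul_apply, ← h2 c hc, aut_mul_apply, aut_mul_apply, aut_apply_inv_self, aut_mul_apply]

variable (L M) in
/-- A stage of the back-and-forth: an automorphism and a finite set. -/
structure PartialConj (g g' : M ≃[L] M) where
  set : Finset M
  map : M ≃[L] M
  inv : Inv g set
  comm : ∀ a ∈ set, map (g a) = g' (map a)

/-- One step forth for `g`, then one step back with the roles of `g` and `g'` exchanged and `k⁻¹` in
place of `k`. Catching the preimage of `x` as well makes the inverses of the stages stabilise. -/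
theorem PartialConj.exists_extend {g g' : M ≃[L] M} (hg : IsHomogeneousAut g)
    (hg' : IsHomogeneousAut g') (x : M) (p : PartialConj L M g g') :
    ∃ q : PartialConj L M g g', p.set ⊆ q.set ∧ (∀ a ∈ p.set, q.map a = p.map a) ∧ x ∈ q.set ∧
      q.map⁻¹ x ∈ q.set := by
  classical
  obtain ⟨C, k, h1, h2, h3, h4, h5⟩ := hg.exists_extend_conj hg' p.inv p.comm {x}
  have mem_im : ∀ x, k x ∈ C.image k ↔ x ∈ C := fun x => by simp [k.injective.eq_iff]
  have hC' : Inv g' (C.image k) := Inv.of_forall g'.injective fun y hy => by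
    obtain ⟨c, hc, rfl⟩ := Finset.mem_image.1 hy
    rw [← h4 c hc, mem_im]
    exact (h3 c).2 hc
  obtain ⟨E, l, k1, k2, k3, k4, k5⟩ := hg'.exists_extend_conj hg (k := k⁻¹) hC'
    (fun a ha => by
      obtain ⟨c, hc, rfl⟩ := Finset.mem_image.1 ha
      rw [← h4 c hc, aut_inv_apply_self, aut_inv_apply_self]) {x}
  have mem_im' : ∀ x, l x ∈ E.image l ↔ x ∈ E := fun x => by simp [l.injective.eq_iff]
  have hl : ∀ c ∈ C, l⁻¹ c = k c := fun c hc => by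
    rw [aut_inv_eq_iff, k5 _ ((mem_im c).2 hc), aut_inv_apply_self]
  have hCE : C ⊆ E.image l := fun c hc => by
    have : l (k c) ∈ E.image l := (mem_im' _).2 (k1 ((mem_im c).2 hc))
    rwa [← hl c hc, aut_apply_inv_self] at this
  refine ⟨⟨E.image l, l⁻¹, Inv.of_forall g.injective fun y hy => ?_, fun a ha => ?_⟩,
    h1.trans hCE, fun a ha => by rw [hl a (h1 ha), h5 a ha], hCE (h2 (by simp)), ?_⟩
  · obtain ⟨c, hc, rfl⟩ := Finset.mem_image.1 hy
    rw [← k4 c hc, mem_im']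
    exact (k3 c).2 hc
  · obtain ⟨c, hc, rfl⟩ := Finset.mem_image.1 ha
    rw [← k4 c hc, aut_inv_apply_self, aut_inv_apply_self]
  · rw [inv_inv]
    exact (mem_im' x).2 (k2 (by simp))

theorem IsHomogeneousAut.isConj [Countable M] {g g' : M ≃[L] M} (hg : IsHomogeneousAut g)
    (hg' : IsHomogeneousAut g') : IsConj g g' := by
  classical
  rcases isEmpty_or_nonempty M with hM | hM
  · have : g = g' := FirstOrder.Language.Equiv.ext fun x => isEmptyElim x
    exact this ▸ IsConj.refl g
  obtain ⟨e, he⟩ := exists_surjective_nat M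
  choose next n1 n2 n3 n4 using fun (x : M) (p : PartialConj L M g g') =>
    p.exists_extend hg hg' x
  let p : ℕ → PartialConj L M g g' := fun n =>
    Nat.rec ⟨∅, 1, fun x => by simp, fun a ha => by simp at ha⟩ (fun n q => next (e n) q) n
  have p_succ : ∀ n, p (n + 1) = next (e n) (p n) := fun n => rfl
  have mono : ∀ m n, m ≤ n → (p m).set ⊆ (p n).set ∧ ∀ a ∈ (p m).set, (p n).map a = (p m).map a := by
    intro m n hmn
    induction n, hmn using Nat.le_induction with
    | base => exact ⟨subset_rfl, fun _ _ => rfl⟩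
    | succ n _ ih =>
      rw [p_succ]
      exact ⟨ih.1.trans (n1 _ _), fun a ha => (n2 _ _ a (ih.1 ha)).trans (ih.2 a ha)⟩
  have cover : ∀ x, ∃ n, x ∈ (p n).set ∧ (p n).map⁻¹ x ∈ (p n).set := fun x => by
    obtain ⟨n, rfl⟩ := he x
    exact ⟨n + 1, n3 _ _, n4 _ _⟩
  choose N hN1 hN2 using cover
  -- From stage `N x` on, both the map and its inverse are constant at `x`, so the stages have an
  -- automorphism as pointwise limit.
  have val : ∀ x n, N x ≤ n → (p n).map x = (p (N x)).map x ∧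
      (p n).map⁻¹ x = (p (N x)).map⁻¹ x := fun x n hn => by
    refine ⟨(mono _ _ hn).2 x (hN1 x), ?_⟩
    rw [aut_inv_eq_iff, (mono _ _ hn).2 _ (hN2 x), aut_apply_inv_self]
  obtain ⟨k, hk, -⟩ := exists_aut_of_forall_finset (L := L) (fun x => (p (N x)).map x)
    (fun x => (p (N x)).map⁻¹ x) fun F =>
      ⟨(p (F.sup N)).map, fun x hx => (val x _ (Finset.le_sup hx)).1,
        fun x hx => (val x _ (Finset.le_sup hx)).2⟩
  refine isConj_iff.2 ⟨k, FirstOrder.Language.Equiv.ext fun x => ?_⟩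
  obtain ⟨x, rfl⟩ : ∃ y, k y = x := ⟨_, aut_apply_inv_self k x⟩
  rw [aut_mul_apply, aut_mul_apply, aut_inv_apply_self, hk, hk,
    ← (val x _ (le_max_left _ (N (g x)))).1, ← (val (g x) _ (le_max_right (N x) _)).1]
  exact (p _).comm x ((mono _ _ (le_max_left _ _)).1 (hN1 x))

theorem IsHomogeneousAut.inv {g : M ≃[L] M} (hg : IsHomogeneousAut g) : IsHomogeneousAut g⁻¹ := by
  constructor
  · intro F
    obtain ⟨C, h1, h2⟩ := hg.locallyFinite F
    exact ⟨C, h1, h2.inv⟩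
  · intro A B h hAB hA hB e
    have hA' := hA.inv
    rw [inv_inv] at hA'
    obtain ⟨f, h1, h2⟩ := hg.extension A B h⁻¹ hAB hA' hB.inv fun a ha => by
      rw [aut_inv_eq_iff, e _ ((hA' a).2 ha), aut_inv_apply_self]
    refine ⟨f, h1, fun b hb => ?_⟩
    rw [aut_inv_eq_iff, h2 _ ((hB b).2 hb), aut_inv_apply_self]

/-- The set `A` is invariant under `g ^ (m + 1)` but perhaps not under `g`, while `root` needs a
`g`-invariant base. Hence `B` is first amalgamated with a `g`-invariant `A' ⊇ A`; the root found
over `A'` is then realised inside `g`. -/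
theorem IsHomogeneousAut.pow (HA : HasEquivariantAmalgams L M) {g : M ≃[L] M}
    (hg : IsHomogeneousAut g) (m : ℕ) : IsHomogeneousAut (g ^ (m + 1)) := by
  classical
  constructor
  · intro F
    obtain ⟨C, h1, h2⟩ := hg.locallyFinite F
    exact ⟨C, h1, h2.pow _⟩
  · intro A B h hAB hA hB e
    obtain ⟨A', hAA', hA'⟩ := hg.locallyFinite A
    obtain ⟨g₁, f₁, h1, h2, h3⟩ := HA.pair hAB hAA' hA hB (hA'.pow (m + 1)) e
    have hB' : Inv g₁ (A' ∪ B.image f₁) := Inv.of_forall g₁.injective fun x hx => by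
      rcases Finset.mem_union.1 hx with hx | hx
      · rw [h1 x hx]
        exact Finset.mem_union_left _ ((hA'.pow _ x).2 hx)
      · obtain ⟨b, hb, rfl⟩ := Finset.mem_image.1 hx
        rw [h3 b hb]
        exact Finset.mem_union_right _ (Finset.mem_image_of_mem _ ((hB b).2 hb))
    obtain ⟨g₂, C, k1, k2, k3, k4⟩ := HA.root m Finset.subset_union_left hA' hB' h1
    obtain ⟨f, l1, l2⟩ := hg.extension A' C g₂ (Finset.subset_union_left.trans k3) hA' k4 k1
    refine ⟨f * f₁, fun a ha => by rw [aut_mul_apply, h2 a ha, l1 a (hAA' ha)], fun b hb => ?_⟩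
    have hpow : ∀ n, ∀ c ∈ C, (g ^ n) (f c) = f ((g₂ ^ n) c) := by
      intro n c hc
      induction n with
      | zero => simp only [pow_zero, aut_one_apply]
      | succ n ih => rw [pow_succ', aut_mul_apply, ih, l2 _ ((k4.pow n c).2 hc), pow_succ',
          aut_mul_apply]
    have hfb : f₁ b ∈ A' ∪ B.image f₁ :=
      Finset.mem_union_right _ (Finset.mem_image_of_mem _ hb)
    rw [aut_mul_apply, hpow _ _ (k3 hfb), k2 _ hfb, h3 b hb, aut_mul_apply]

/-- Generic automorphisms exist and are conjugate to their nontrivial powers, as soon as finite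
partial automorphisms extend to finite automorphisms and these amalgamate equivariantly. -/
theorem exists_generic_and_conj_zpow [Countable M] (HF : HasFiniteExtensions L M)
    (HA : HasEquivariantAmalgams L M) :
    (∃ g : M ≃[L] M, IsGenericAut g) ∧
      ∀ g : M ≃[L] M, IsGenericAut g →
        (∀ n : ℕ, 1 ≤ n → ∃ h : M ≃[L] M, h ^ n = g) ∧ (∀ n : ℤ, n ≠ 0 → IsConj g (g ^ n)) := by
  have hres := isHomogeneousAut_mem_residual HF HA
  have hpow : ∀ {g : M ≃[L] M}, IsHomogeneousAut g → ∀ n : ℕ, n ≠ 0 → IsHomogeneousAut (g ^ n) :=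
    fun hg n hn => by
      obtain ⟨m, rfl⟩ := Nat.exists_eq_succ_of_ne_zero hn
      exact hg.pow HA m
  constructor
  · obtain ⟨g, hg⟩ := (dense_of_mem_residual hres).nonempty
    exact ⟨g, Filter.mem_of_superset hres fun h hh => hg.isConj hh⟩
  · intro g hgen
    -- Two comeagre sets meet in a Baire space, so the class of `g` contains a homogeneous
    -- automorphism; homogeneity is invariant under conjugation.
    obtain ⟨h, hgh, hh⟩ := (dense_of_mem_residual (Filter.inter_mem hgen hres)).nonempty
    obtain ⟨k, rfl⟩ := isConj_iff.1 hgh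
    have hg : IsHomogeneousAut g := by
      have := IsHomogeneousAut.conj hh k⁻¹
      rwa [show k⁻¹ * (k * g * k⁻¹) * (k⁻¹)⁻¹ = g by group] at this
    refine ⟨fun n hn => ?_, fun n hn => ?_⟩
    · obtain ⟨c, hc⟩ := isConj_iff.1 ((hpow hg n (by omega)).isConj hg)
      exact ⟨c * g * c⁻¹, by rw [conj_pow, hc]⟩
    · obtain ⟨m, rfl | rfl⟩ := n.eq_nat_or_neg
      · rw [zpow_natCast]
        exact hg.isConj (hpow hg m (by simpa using hn))
      · rw [zpow_neg, zpow_natCast]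
        exact hg.isConj (hpow hg m (by simpa using hn)).inv

end Aut

end FirstOrder.Language.Equiv

/-! ### Ultrametrics with relations and their equivariant amalgamation -/

namespace UltrametricData

/-- The nonzero distances: the set `S`, or `{0}` if `S` is empty. -/
def Radius (D : UltrametricData) : Type := {x : ℝ // x ∈ D.S ∨ (D.S = ∅ ∧ x = 0)}

noncomputable instance (D : UltrametricData) : LinearOrder D.Radius :=
  inferInstanceAs (LinearOrder {x : ℝ // x ∈ D.S ∨ (D.S = ∅ ∧ x = 0)})

instance (D : UltrametricData) : Nonempty D.Radius := by
  rcases D.S.eq_empty_or_nonempty with h | ⟨s, hs⟩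
  · exact ⟨⟨0, Or.inr ⟨h, rfl⟩⟩⟩
  · exact ⟨⟨s, Or.inl hs⟩⟩

/-- An ultrametric with nonzero distances in `D.Radius` together with relations `P_i` that are
symmetric and hold of distinct points only. -/
structure UMetric (D : UltrametricData) (X : Type*) where
  d : X → X → WithBot D.Radius
  P : ∀ i, (Fin (D.arity i) → X) → Prop
  d_eq_bot : ∀ x y, d x y = ⊥ ↔ x = y
  d_comm : ∀ x y, d x y = d y x
  d_ultra : ∀ x y z, d x z ≤ max (d x y) (d y z)
  P_sym : ∀ i, ∀ θ ∈ D.sym i, ∀ x, P i (x ∘ θ) → P i x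
  P_inj : ∀ i x, P i x → Function.Injective x

namespace UMetric

variable {D : UltrametricData} {X : Type*} {Y : Type*} {Z : Type*}

theorem d_self (M : UMetric D X) (x : X) : M.d x x = ⊥ := (M.d_eq_bot x x).2 rfl

theorem d_le (M : UMetric D X) {x y z : X} {r : WithBot D.Radius} (h₁ : M.d x y ≤ r)
    (h₂ : M.d y z ≤ r) : M.d x z ≤ r := (M.d_ultra x y z).trans (max_le h₁ h₂)

theorem P_sym_iff (M : UMetric D X) {i : Fin D.r} {θ : Equiv.Perm (Fin (D.arity i))}
    (hθ : θ ∈ D.sym i) (x : Fin (D.arity i) → X) : M.P i (x ∘ θ) ↔ M.P i x := by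
  refine ⟨M.P_sym i θ hθ x, fun h => M.P_sym i θ⁻¹ (inv_mem hθ) _ ?_⟩
  rwa [Function.comp_assoc, ← Equiv.Perm.coe_mul, mul_inv_cancel, Equiv.Perm.coe_one,
    Function.comp_id]

/-- The map `f` preserves distances and the relations `P_i`, in both directions. -/
structure IsEmb (M : UMetric D X) (N : UMetric D Y) (f : X → Y) : Prop where
  d_map : ∀ x y, N.d (f x) (f y) = M.d x y
  P_map : ∀ i x, N.P i (f ∘ x) ↔ M.P i x

theorem IsEmb.injective {M : UMetric D X} {N : UMetric D Y} {f : X → Y} (hf : IsEmb M N f) :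
    Function.Injective f := fun x y h => by
  rwa [← M.d_eq_bot, ← hf.d_map, N.d_eq_bot]

theorem IsEmb.comp {M : UMetric D X} {N : UMetric D Y} {O : UMetric D Z} {g : Y → Z} {f : X → Y}
    (hg : IsEmb N O g) (hf : IsEmb M N f) : IsEmb M O (g ∘ f) :=
  ⟨fun x y => (hg.d_map _ _).trans (hf.d_map x y),
    fun i x => (hg.P_map i (f ∘ x)).trans (hf.P_map i x)⟩

/-- The structure induced along an injective map. -/
def comap (M : UMetric D Y) (f : X → Y) (hf : Function.Injective f) : UMetric D X where
  d x y := M.d (f x) (f y)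
  P i x := M.P i (f ∘ x)
  d_eq_bot _ _ := (M.d_eq_bot _ _).trans hf.eq_iff
  d_comm _ _ := M.d_comm _ _
  d_ultra _ _ _ := M.d_ultra _ _ _
  P_sym i θ hθ _ h := M.P_sym i θ hθ _ h
  P_inj i _ h := (M.P_inj i _ h).of_comp

theorem isEmb_comap (M : UMetric D Y) (f : X → Y) (hf : Function.Injective f) :
    IsEmb (M.comap f hf) M f := ⟨fun _ _ => rfl, fun _ _ => Iff.rfl⟩

/-- The structure induced on a finite set. -/
abbrev restrict (M : UMetric D X) (A : Finset X) : UMetric D A :=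
  M.comap Subtype.val Subtype.val_injective

theorem exists_bound (M : UMetric D X) (C : Finset X) :
    ∃ t : WithBot D.Radius, t ≠ ⊥ ∧ ∀ x ∈ C, ∀ y ∈ C, M.d x y ≤ t := by
  obtain ⟨r⟩ : Nonempty D.Radius := inferInstance
  refine ⟨max (r : WithBot D.Radius) ((C ×ˢ C).sup fun p => M.d p.1 p.2), fun h => ?_,
    fun x hx y hy => ?_⟩
  · have := le_max_left (r : WithBot D.Radius) ((C ×ˢ C).sup fun p => M.d p.1 p.2)
    rw [h, le_bot_iff] at this
    exact WithBot.coe_ne_bot this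
  · exact le_max_of_le_right
      (Finset.le_sup (f := fun p : X × X => M.d p.1 p.2) (Finset.mk_mem_product hx hy))

section Amalgam

variable {I : Type} [DecidableEq I] (M : UMetric D X) (A : Finset X) (t : WithBot D.Radius)

/-- The distance between points of copies, indexed by `I`, of `X` that are amalgamated over `A`:
between different copies the distance is measured through `A`, with the bound `t`. -/
noncomputable def copyDist (x y : I × X) : WithBot D.Radius :=
  if x.1 = y.1 then M.d x.2 y.2 else A.fold min t fun a => max (M.d x.2 a) (M.d a y.2)

theorem copyDist_same (i : I) (b c : X) : copyDist M A t (i, b) (i, c) = M.d b c := if_pos rfl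

theorem copyDist_le_iff {x y : I × X} (h : x.1 ≠ y.1) {r : WithBot D.Radius} :
    copyDist M A t x y ≤ r ↔ t ≤ r ∨ ∃ a ∈ A, M.d x.2 a ≤ r ∧ M.d a y.2 ≤ r := by
  rw [copyDist, if_neg h, Finset.fold_min_le]
  simp only [max_le_iff]

theorem copyDist_comm (x y : I × X) : copyDist M A t x y = copyDist M A t y x := by
  by_cases h : x.1 = y.1
  · rw [copyDist, copyDist, if_pos h, if_pos h.symm, M.d_comm]
  · refine eq_of_forall_ge_iff fun r => ?_
    rw [copyDist_le_iff M A t h, copyDist_le_iff M A t (Ne.symm h)]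
    simp only [M.d_comm x.2, M.d_comm _ y.2, and_comm]

/-- A path between different copies passes through `A` or costs at least `t`. Detours through `A`
obey the triangle inequality of `M`, and a path that leaves a copy and returns at cost `t` is
harmless, as `t` bounds the distances inside each `B i`. -/
theorem copyDist_ultra {B : I → Finset X} (ht : ∀ i, ∀ x ∈ B i, ∀ y ∈ B i, M.d x y ≤ t)
    {x y z : I × X} (hx : x.2 ∈ B x.1) (hz : z.2 ∈ B z.1) {r : WithBot D.Radius}
    (h₁ : copyDist M A t x y ≤ r) (h₂ : copyDist M A t y z ≤ r) : copyDist M A t x z ≤ r := by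
  obtain ⟨i, b⟩ := x
  obtain ⟨j, c⟩ := y
  obtain ⟨k, e⟩ := z
  by_cases hik : i = k
  · subst hik
    rw [copyDist_same]
    by_cases hij : i = j
    · subst hij
      rw [copyDist_same] at h₁ h₂
      exact M.d_le h₁ h₂
    · rw [copyDist_le_iff M A t hij] at h₁
      rw [copyDist_le_iff M A t (Ne.symm hij)] at h₂
      obtain h₁ | ⟨a, -, h1, h2⟩ := h₁
      · exact (ht i b hx e hz).trans h₁
      obtain h₂ | ⟨a', -, h3, h4⟩ := h₂
      · exact (ht i b hx e hz).trans h₂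
      exact M.d_le (M.d_le h1 h2) (M.d_le h3 h4)
  · rw [copyDist_le_iff M A t hik]
    by_cases hij : i = j
    · subst hij
      rw [copyDist_same] at h₁
      rw [copyDist_le_iff M A t hik] at h₂
      exact h₂.imp id fun ⟨a, ha, h3, h4⟩ => ⟨a, ha, M.d_le h₁ h3, h4⟩
    · rw [copyDist_le_iff M A t hij] at h₁
      obtain h₁ | ⟨a, ha, h1, h2⟩ := h₁
      · exact Or.inl h₁
      by_cases hjk : j = k
      · subst hjk
        rw [copyDist_same] at h₂
        exact Or.inr ⟨a, ha, h1, M.d_le h2 h₂⟩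
      · rw [copyDist_le_iff M A t hjk] at h₂
        obtain h₂ | ⟨a', ha', h3, h4⟩ := h₂
        · exact Or.inl h₂
        exact Or.inr ⟨a, ha, h1, M.d_le (M.d_le h2 h3) h4⟩

theorem eq_of_copyDist_eq_bot (ht : t ≠ ⊥) {x y : I × X} (h : copyDist M A t x y = ⊥) :
    x.2 = y.2 := by
  obtain ⟨i, b⟩ := x
  obtain ⟨j, c⟩ := y
  by_cases hij : i = j
  · subst hij
    rwa [copyDist_same, M.d_eq_bot] at h
  · rw [← le_bot_iff, copyDist_le_iff M A t hij] at h
    simp only [le_bot_iff, M.d_eq_bot, ht, false_or] at h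
    obtain ⟨a, -, h1, h2⟩ := h
    exact h1.trans h2

theorem copyDist_of_mem {a : X} (ha : a ∈ A) (i j : I) : copyDist M A t (i, a) (j, a) = ⊥ := by
  by_cases hij : i = j
  · subst hij
    rw [copyDist_same, d_self]
  · rw [← le_bot_iff, copyDist_le_iff M A t hij]
    exact Or.inr ⟨a, ha, (M.d_self a).le, (M.d_self a).le⟩

/-- The maps `β i` agree on `A` and permute it, so they carry the points of `A` through which
distances are measured to one another. -/
theorem copyDist_map {π : I → I} (hπ : Function.Injective π) {β : I → X → X}
    (hβ : ∀ i, IsEmb M M (β i)) (hsurj : ∀ i, Function.Surjective (β i))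
    (hA : ∀ i a, β i a ∈ A ↔ a ∈ A) (hβA : ∀ i j, ∀ a ∈ A, β i a = β j a) (i j : I) (b c : X) :
    copyDist M A t (π i, β i b) (π j, β j c) = copyDist M A t (i, b) (j, c) := by
  by_cases hij : i = j
  · subst hij
    rw [copyDist_same, copyDist_same, (hβ i).d_map]
  · refine eq_of_forall_ge_iff fun r => ?_
    rw [copyDist_le_iff M A t (x := (i, b)) (y := (j, c)) hij,
      copyDist_le_iff M A t (x := (π i, β i b)) (y := (π j, β j c)) (hπ.ne hij)]
    refine or_congr Iff.rfl ⟨?_, ?_⟩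
    · rintro ⟨a, ha, h1, h2⟩
      obtain ⟨a, rfl⟩ := hsurj i a
      have ha' := (hA i a).1 ha
      refine ⟨a, ha', by rwa [(hβ i).d_map] at h1, ?_⟩
      rwa [hβA i j a ha', (hβ j).d_map] at h2
    · rintro ⟨a, ha, h1, h2⟩
      refine ⟨β i a, (hA i a).2 ha, by rwa [(hβ i).d_map], ?_⟩
      rwa [hβA i j a ha, (hβ j).d_map]

end Amalgam

/-- The amalgam is the disjoint union of the `B i` modulo distance `⊥`, which glues exactly the
copies of `A`. A relation holds only for tuples lying in a single copy. -/
theorem exists_amalgam {X : Type u} (M : UMetric D X) {I : Type} [Finite I] {π : I → I}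
    (hπ : Function.Injective π) {A : Finset X} {B : I → Finset X} (hAB : ∀ i, A ⊆ B i)
    {β : I → X → X} (hβ : ∀ i, IsEmb M M (β i)) (hsurj : ∀ i, Function.Surjective (β i))
    (hB : ∀ i b, β i b ∈ B (π i) ↔ b ∈ B i)
    (hA : ∀ i a, β i a ∈ A ↔ a ∈ A) (hβA : ∀ i j, ∀ a ∈ A, β i a = β j a) :
    ∃ (Y : Type u) (_ : Finite Y) (N : UMetric D Y) (κ : (i : I) → B i → Y) (δ : Y → Y),
      (∀ i, IsEmb (M.restrict (B i)) N (κ i)) ∧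
      (∀ i j a (ha : a ∈ A), κ i ⟨a, hAB i ha⟩ = κ j ⟨a, hAB j ha⟩) ∧
      IsEmb N N δ ∧ ∀ i b (hb : b ∈ B i), δ (κ i ⟨b, hb⟩) = κ (π i) ⟨β i b, (hB i b).2 hb⟩ := by
  classical
  have := Fintype.ofFinite I
  obtain ⟨t, ht, htB⟩ := M.exists_bound (Finset.univ.biUnion B)
  replace htB : ∀ i, ∀ x ∈ B i, ∀ y ∈ B i, M.d x y ≤ t := fun i x hx y hy =>
    htB x (Finset.mem_biUnion.2 ⟨i, Finset.mem_univ _, hx⟩) y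
      (Finset.mem_biUnion.2 ⟨i, Finset.mem_univ _, hy⟩)
  let Y₀ : Type u := {x : I × X // x.2 ∈ B x.1}
  have hY₀ : Finite Y₀ := by
    refine Finite.of_injective (β := I × (Finset.univ.biUnion B : Finset X))
      (fun x => (x.1.1, ⟨x.1.2, Finset.mem_biUnion.2 ⟨_, Finset.mem_univ _, x.2⟩⟩)) ?_
    rintro ⟨⟨i, b⟩, _⟩ ⟨⟨j, c⟩, _⟩ h
    simp only [Prod.mk.injEq, Subtype.mk.injEq] at h
    exact Subtype.ext (Prod.ext h.1 h.2)
  let d₀ : Y₀ → Y₀ → WithBot D.Radius := fun x y => copyDist M A t x.1 y.1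
  have d₀_self : ∀ x, d₀ x x = ⊥ := fun x => by
    change copyDist M A t (x.1.1, x.1.2) (x.1.1, x.1.2) = ⊥
    rw [copyDist_same, d_self]
  have d₀_comm : ∀ x y, d₀ x y = d₀ y x := fun x y => copyDist_comm M A t _ _
  have d₀_le : ∀ {x y z r}, d₀ x y ≤ r → d₀ y z ≤ r → d₀ x z ≤ r := fun {x y z r} h₁ h₂ =>
    copyDist_ultra M A t htB x.2 z.2 h₁ h₂
  let s : Setoid Y₀ := ⟨fun x y => d₀ x y = ⊥, d₀_self, fun {x y} h => (d₀_comm y x).trans h,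
    fun {x y z} h₁ h₂ => le_bot_iff.1 (d₀_le (le_bot_iff.2 h₁) (le_bot_iff.2 h₂))⟩
  let q : Y₀ → Quotient s := Quotient.mk s
  have hout : ∀ x, d₀ (q x).out x = ⊥ := fun x => Quotient.mk_out (s := s) x
  have q_eq : ∀ x y, q x = q y ↔ d₀ x y = ⊥ := fun x y => Quotient.eq (r := s)
  have out_d : ∀ x y, d₀ (q x).out (q y).out = d₀ x y := fun x y => by
    refine le_antisymm ?_ ?_
    · exact d₀_le ((hout x).le.trans bot_le)
        (d₀_le le_rfl (by rw [d₀_comm, hout]; exact bot_le))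
    · exact d₀_le (by rw [d₀_comm, hout]; exact bot_le) (d₀_le le_rfl ((hout y).le.trans bot_le))
  let κ : (i : I) → B i → Quotient s := fun i b => q ⟨(i, b), b.2⟩
  have κ_val : ∀ {i j b c}, κ i b = κ j c → (b : X) = c := fun {i j b c} h =>
    eq_of_copyDist_eq_bot M A t ht ((q_eq _ _).1 h)
  let N : UMetric D (Quotient s) :=
    { d := fun x y => d₀ x.out y.out
      P := fun l x => ∃ (i : I) (b : Fin (D.arity l) → B i), κ i ∘ b = x ∧
        M.P l (Subtype.val ∘ b)
      d_eq_bot := fun x y => by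
        rw [← q_eq]
        simp only [q, Quotient.out_eq]
      d_comm := fun x y => d₀_comm _ _
      d_ultra := fun x y z => d₀_le (le_max_left _ _) (le_max_right _ _)
      P_sym := by
        rintro l θ hθ x ⟨i, b, h1, h2⟩
        have h3 := (M.P_sym_iff (inv_mem hθ) _).2 h2
        refine ⟨i, b ∘ (θ⁻¹ : Equiv.Perm _), ?_, h3⟩
        rw [← Function.comp_assoc, h1, Function.comp_assoc, ← Equiv.Perm.coe_mul, mul_inv_cancel,
          Equiv.Perm.coe_one, Function.comp_id]
      P_inj := by
        rintro l x ⟨i, b, rfl, h2⟩ m n h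
        exact M.P_inj l _ h2 (κ_val h) }
  have hκ : ∀ i, IsEmb (M.restrict (B i)) N (κ i) := fun i => by
    refine ⟨fun b c => ?_, fun l x => ⟨?_, fun h => ⟨i, x, rfl, h⟩⟩⟩
    · change d₀ (q _).out (q _).out = _
      rw [out_d]
      exact copyDist_same M A t i _ _
    · rintro ⟨j, b, h1, h2⟩
      have : Subtype.val ∘ b = Subtype.val ∘ x := funext fun m => κ_val (congrFun h1 m)
      rw [this] at h2
      exact h2
  let δ₀ : Y₀ → Y₀ := fun x => ⟨(π x.1.1, β x.1.1 x.1.2), (hB _ _).2 x.2⟩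
  have δ₀_d : ∀ x y, d₀ (δ₀ x) (δ₀ y) = d₀ x y := fun x y =>
    copyDist_map M A t hπ hβ hsurj hA hβA _ _ _ _
  let δ : Quotient s → Quotient s := fun x => q (δ₀ x.out)
  have δ_q : ∀ x, δ (q x) = q (δ₀ x) := fun x => by
    rw [q_eq, δ₀_d, hout]
  have δ_κ : ∀ i b (hb : b ∈ B i), δ (κ i ⟨b, hb⟩) = κ (π i) ⟨β i b, (hB i b).2 hb⟩ :=
    fun i b hb => δ_q _
  have δ_d : ∀ x y, N.d (δ x) (δ y) = N.d x y := fun x y => by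
    change d₀ (q _).out (q _).out = _
    rw [out_d, δ₀_d]
  have δ_inj : Function.Injective δ := fun x y h => by
    rwa [← N.d_eq_bot, ← δ_d, N.d_eq_bot]
  refine ⟨Quotient s, inferInstance, N, κ, δ, hκ, fun i j a ha => ?_, ⟨δ_d, fun l x => ⟨?_, ?_⟩⟩,
    δ_κ⟩
  · rw [q_eq]
    exact copyDist_of_mem M A t ha i j
  · rintro ⟨i, b, h1, h2⟩
    -- Every copy is the image of another, as an injection of a finite index set is onto; so
    -- relations can be pulled back along `δ`.
    obtain ⟨i, rfl⟩ := (Finite.injective_iff_surjective.1 hπ) i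
    choose c hc using fun m => hsurj i (b m)
    have hcB : ∀ m, c m ∈ B i := fun m => (hB i _).1 (by rw [hc m]; exact (b m).2)
    have hb : b = fun m => ⟨β i (c m), (hB i _).2 (hcB m)⟩ := funext fun m => Subtype.ext (hc m).symm
    refine ⟨i, fun m => ⟨c m, hcB m⟩, funext fun m => δ_inj ?_, ?_⟩
    · change δ (κ i ⟨c m, hcB m⟩) = (δ ∘ x) m
      rw [δ_κ, ← h1, hb]
      rfl
    · rw [hb] at h2
      exact ((hβ i).P_map l c).1 h2
  · rintro ⟨i, b, rfl, h2⟩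
    exact ⟨π i, fun m => ⟨β i (b m), (hB i _).2 (b m).2⟩, funext fun m => (δ_κ i _ _).symm,
      ((hβ i).P_map l _).2 h2⟩

end UMetric

end UltrametricData

/-! ### Extending partial automorphisms of finite structures -/

theorem exists_perm_apply_eq {α J : Type*} [Finite α] (a b : J → α)
    (h : ∀ i j, a i = a j ↔ b i = b j) : ∃ ρ : Equiv.Perm α, ∀ i, ρ (a i) = b i := by
  classical
  have := Fintype.ofFinite α
  let e : {x // x ∈ Set.range a} → {x // x ∈ Set.range b} := fun x => ⟨b x.2.choose, _, rfl⟩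
  have he : ∀ i (hi : a i ∈ Set.range a), e ⟨a i, hi⟩ = ⟨b i, i, rfl⟩ := fun i hi =>
    Subtype.ext ((h _ _).1 hi.choose_spec)
  have hbij : Function.Bijective e := by
    constructor
    · rintro ⟨_, i, rfl⟩ ⟨_, j, rfl⟩ hij
      rw [he i ⟨i, rfl⟩, he j ⟨j, rfl⟩] at hij
      exact Subtype.ext ((h _ _).2 (congrArg Subtype.val hij))
    · rintro ⟨_, i, rfl⟩
      exact ⟨⟨a i, i, rfl⟩, he i _⟩
  refine ⟨(Equiv.ofBijective e hbij).extendSubtype, fun i => ?_⟩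
  rw [Equiv.extendSubtype_apply_of_mem _ _ ⟨i, rfl⟩]
  exact congrArg Subtype.val (he i _)

namespace UltrametricData

namespace UMetric

variable {D : UltrametricData}

theorem d_lt_iff_of_d_lt {X : Type*} (M : UMetric D X) {x y z : X} {r : WithBot D.Radius}
    (h : M.d x y < r) : M.d x z < r ↔ M.d y z < r :=
  ⟨fun h' => (M.d_ultra y x z).trans_lt (max_lt (by rwa [M.d_comm]) h'),
    fun h' => (M.d_ultra x y z).trans_lt (max_lt h h')⟩

theorem exists_lower_bound {X : Type*} [Finite X] (M : UMetric D X) :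
    ∃ m : WithBot D.Radius, m ≠ ⊥ ∧ ∀ x y, x ≠ y → m ≤ M.d x y := by
  by_cases h : ∃ p : X × X, p.1 ≠ p.2
  · obtain ⟨p, hp, hmin⟩ := Set.exists_min_image {p : X × X | p.1 ≠ p.2} (fun p => M.d p.1 p.2)
      (Set.toFinite _) h
    exact ⟨M.d p.1 p.2, fun e => hp ((M.d_eq_bot _ _).1 e), fun x y hxy => hmin (x, y) hxy⟩
  · obtain ⟨r⟩ : Nonempty D.Radius := inferInstance
    exact ⟨r, WithBot.coe_ne_bot, fun x y hxy => absurd ⟨(x, y), hxy⟩ h⟩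

/-- A partial isometry of a finite structure extends to an isometry of a finite extension. -/
theorem exists_isometry_extension {X : Type u} [Finite X] (M : UMetric D X) (dom : Set X)
    (p : X → X) (hp : ∀ x ∈ dom, ∀ y ∈ dom, M.d (p x) (p y) = M.d x y) :
    ∃ (Y : Type u) (_ : Finite Y) (N : UMetric D Y) (ι : X → Y) (π : Equiv.Perm Y),
      IsEmb M N ι ∧ (∀ x y, N.d (π x) (π y) = N.d x y) ∧ ∀ x ∈ dom, π (ι x) = ι (p x) := by
  classical
  let W : Type := {r : WithBot D.Radius // r ≠ ⊥ ∧ r ∈ Set.range fun q : X × X => M.d q.1 q.2}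
  have hW : Finite W := Set.Finite.subset (Set.finite_range _) fun r hr => hr.2
  have := Fintype.ofFinite W
  -- The distance of two families is the largest `w` at which they differ, so permuting each
  -- coordinate separately is an isometry.
  let d : (W → Set X) → (W → Set X) → WithBot D.Radius := fun f g =>
    (Finset.univ.filter fun w => f w ≠ g w).sup Subtype.val
  have d_le : ∀ f g r, d f g ≤ r ↔ ∀ w : W, r < w → f w = g w := fun f g r => by
    simp only [d, Finset.sup_le_iff, Finset.mem_filter, Finset.mem_univ, true_and]
    exact forall_congr' fun w => by rw [← not_imp_not, not_le, not_not]
  -- A point goes to the family of its open balls. The partial isometry induces, for each radius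
  -- `w`, a partial injection on balls, which extends to a permutation `ρ w`.
  let ι : X → W → Set X := fun x w => {z | M.d x z < w}
  have ι_eq : ∀ x y (w : W), ι x w = ι y w ↔ M.d x y < w := fun x y w => by
    constructor
    · intro h
      have : y ∈ ι y w := by
        change M.d y y < w
        rw [d_self]
        exact bot_lt_iff_ne_bot.2 w.2.1
      rw [← h] at this
      exact this
    · exact fun h => Set.ext fun z => M.d_lt_iff_of_d_lt h
  have ι_d : ∀ x y, d (ι x) (ι y) = M.d x y := fun x y => by
    refine eq_of_forall_ge_iff fun r => ?_
    rw [d_le]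
    simp only [ι_eq]
    constructor
    · intro h
      by_contra hr
      rw [not_le] at hr
      exact lt_irrefl _ (h ⟨M.d x y, (bot_le.trans_lt hr).ne', (x, y), rfl⟩ hr)
    · exact fun h w hw => h.trans_lt hw
  have ι_inj : ∀ {x y}, ι x = ι y → x = y := fun {x y} h => by
    rw [← M.d_eq_bot, ← ι_d, ← le_bot_iff, d_le]
    exact fun w _ => congrFun h w
  let N : UMetric D (W → Set X) :=
    { d := d
      P := fun i y => ∃ x, ι ∘ x = y ∧ M.P i x
      d_eq_bot := fun f g => by
        rw [← le_bot_iff, d_le]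
        exact ⟨fun h => funext fun w => h w (bot_lt_iff_ne_bot.2 w.2.1), fun h w _ => congrFun h w⟩
      d_comm := fun f g => eq_of_forall_ge_iff fun r => by
        rw [d_le, d_le]
        exact forall₂_congr fun _ _ => eq_comm
      d_ultra := fun f g h => by
        rw [d_le]
        exact fun w hw => ((d_le f g _).1 (le_max_left _ _) w hw).trans
          ((d_le g h _).1 (le_max_right _ _) w hw)
      P_sym := by
        rintro i θ hθ y ⟨x, h1, h2⟩
        refine ⟨x ∘ (θ⁻¹ : Equiv.Perm _), ?_, (M.P_sym_iff (inv_mem hθ) _).2 h2⟩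
        rw [← Function.comp_assoc, h1, Function.comp_assoc, ← Equiv.Perm.coe_mul, mul_inv_cancel,
          Equiv.Perm.coe_one, Function.comp_id]
      P_inj := by
        rintro i y ⟨x, rfl, h⟩ m n e
        exact M.P_inj i x h (ι_inj e) }
  choose ρ hρ using fun w : W => exists_perm_apply_eq (J := dom) (fun x => ι x w)
    (fun x => ι (p x) w) (fun x y => by
      rw [ι_eq, ι_eq, hp x x.2 y y.2])
  refine ⟨W → Set X, inferInstance, N, ι, Equiv.piCongrRight ρ, ⟨ι_d, fun i x => ⟨?_, ?_⟩⟩,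
    fun f g => eq_of_forall_ge_iff fun r => ?_, fun x hx => ?_⟩
  · rintro ⟨x', h1, h2⟩
    have : x' = x := funext fun m => ι_inj (congrFun h1 m)
    rwa [this] at h2
  · exact fun h => ⟨x, rfl, h⟩
  · change d _ _ ≤ r ↔ d _ _ ≤ r
    rw [d_le, d_le]
    simp only [Equiv.piCongrRight_apply, Pi.map_apply, EmbeddingLike.apply_eq_iff_eq]
  · exact funext fun w => hρ w ⟨x, hx⟩

/-- If an isometry of a finite structure preserves the relations on the tuples from `dom`, then
its restriction to `dom` extends to an automorphism of a finite extension. -/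
theorem exists_relation_extension {X : Type u} [Finite X] (M : UMetric D X) (dom : Set X)
    (π : Equiv.Perm X) (hπ : ∀ x y, M.d (π x) (π y) = M.d x y)
    (hP : ∀ i x, (∀ j, x j ∈ dom) → (M.P i (π ∘ x) ↔ M.P i x)) :
    ∃ (Y : Type u) (_ : Finite Y) (N : UMetric D Y) (ι : X → Y) (σ : Y → Y),
      IsEmb M N ι ∧ IsEmb N N σ ∧ ∀ x ∈ dom, σ (ι x) = ι (π x) := by
  classical
  obtain ⟨m, hm, hmd⟩ := M.exists_lower_bound
  -- Each point receives one bit for every relation symbol and every tuple of `X`; a relation will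
  -- hold when the bits of its entries at the tuple of their base points sum to `1`.
  let V : Type u := (i : Fin D.r) → (Fin (D.arity i) → X) → ZMod 2
  let z : ∀ i, Fin (D.arity i) := fun i => ⟨0, D.arity_pos i⟩
  let ind : ∀ i, (Fin (D.arity i) → X) → ZMod 2 := fun i t => if M.P i t then 1 else 0
  -- The defect of `π` at `t`. It vanishes when all entries of `t` lie in `dom`, so the default `z
  -- i` in `o` is harmless there.
  let c : ∀ i, (Fin (D.arity i) → X) → ZMod 2 := fun i t => ind i (π ∘ t) - ind i t
  let o : ∀ i, (Fin (D.arity i) → X) → Fin (D.arity i) := fun i t =>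
    if h : ∃ j, t j ∉ dom then h.choose else z i
  let χ : X → V := fun x i t => if t (z i) = x then ind i t else 0
  -- The defect is added at the entry `z i`, which carries the truth value in `χ`, and subtracted at
  -- an entry outside `dom`. The parity of the tuple is unchanged, yet on `dom` the bits become
  -- those of the image point.
  let φ : X → V := fun x i t => (if t (z i) = x then c i t else 0) -
    if t (o i t) = x then c i t else 0
  let σ : X × V → X × V := fun y => (π y.1, fun i s => y.2 i (π.symm ∘ s) + φ y.1 i (π.symm ∘ s))
  let ι : X → X × V := fun x => (x, χ x)
  let Q : ∀ i, (Fin (D.arity i) → X × V) → Prop := fun i y =>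
    Function.Injective (Prod.fst ∘ y) ∧ ∑ j, (y j).2 i (Prod.fst ∘ y) = 1
  have sum_ite : ∀ {i} {t : Fin (D.arity i) → X} (_ : Function.Injective t) (k) (e : ZMod 2),
      ∑ j, (if t k = t j then e else 0) = e := fun {i t} ht k e => by
    simp [ht.eq_iff]
  have symm_comp : ∀ {i} (t : Fin (D.arity i) → X), π.symm ∘ π ∘ t = t := fun t =>
    funext fun j => π.symm_apply_apply _
  have Q_σ : ∀ i y, Q i (σ ∘ y) ↔ Q i y := fun i y => by
    have e : Prod.fst ∘ σ ∘ y = π ∘ Prod.fst ∘ y := rfl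
    change Function.Injective (Prod.fst ∘ σ ∘ y) ∧ _ ↔ Function.Injective _ ∧ _
    rw [e, π.injective.of_comp_iff]
    refine and_congr_right fun hy => ?_
    have hsum : ∑ j, φ (y j).1 i (Prod.fst ∘ y) = 0 := by
      simp only [φ, Finset.sum_sub_distrib]
      have h1 := sum_ite hy (z i) (c i (Prod.fst ∘ y))
      have h2 := sum_ite hy (o i (Prod.fst ∘ y)) (c i (Prod.fst ∘ y))
      exact (congrArg₂ _ h1 h2).trans (sub_self _)
    have : ∑ j, ((σ ∘ y) j).2 i (π ∘ Prod.fst ∘ y) = ∑ j, (y j).2 i (Prod.fst ∘ y) := by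
      simp only [σ, Function.comp_apply, symm_comp, Finset.sum_add_distrib]
      rw [hsum, add_zero]
    rw [this]
  have Q_ι : ∀ i x, Q i (ι ∘ x) ↔ M.P i x := fun i x => by
    change Function.Injective x ∧ ∑ j, χ (x j) i x = 1 ↔ _
    constructor
    · rintro ⟨hx, h⟩
      simp only [χ] at h
      rw [sum_ite hx (z i)] at h
      by_contra hn
      simp [ind, hn] at h
    · intro h
      refine ⟨M.P_inj i x h, ?_⟩
      simp only [χ]
      rw [sum_ite (M.P_inj i x h) (z i)]
      simp [ind, h]
  -- Distinct points over the same base point are at distance `m`, at most every nonzero distance of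
  -- `X`; so distances between different fibres are those of `X`.
  let d : X × V → X × V → WithBot D.Radius := fun x y =>
    max (M.d x.1 y.1) (if x.2 = y.2 then ⊥ else m)
  have d_ne : ∀ x y, x.1 ≠ y.1 → d x y = M.d x.1 y.1 := fun x y h => by
    refine max_eq_left ?_
    split_ifs
    · exact bot_le
    · exact hmd _ _ h
  let N : UMetric D (X × V) :=
    { d := d
      P := fun i y => ∃ θ ∈ D.sym i, Q i (y ∘ θ)
      d_eq_bot := fun x y => by
        rw [← le_bot_iff, max_le_iff, le_bot_iff, le_bot_iff, M.d_eq_bot, Prod.ext_iff]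
        simp [hm]
      d_comm := fun x y => by simp only [d, M.d_comm x.1, eq_comm]
      d_ultra := fun x y z => by
        refine max_le ((M.d_ultra _ y.1 _).trans (max_le_max (le_max_left _ _) (le_max_left _ _)))
          ?_
        by_cases h1 : x.2 = y.2
        · exact le_max_of_le_right (le_max_of_le_right (by rw [h1]))
        · exact le_max_of_le_left (le_max_of_le_right (by rw [if_neg h1]; split_ifs <;> simp))
      P_sym := by
        rintro i θ hθ y ⟨θ', hθ', h⟩
        exact ⟨θ * θ', mul_mem hθ hθ', h⟩
      P_inj := by
        rintro i y ⟨θ, _, h, _⟩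
        have : Function.Injective ((Prod.fst ∘ y) ∘ θ) := h
        rw [θ.injective_comp] at this
        exact this.of_comp }
  refine ⟨X × V, inferInstance, N, ι, σ, ⟨fun x y => ?_, fun i x => ⟨?_, ?_⟩⟩,
    ⟨fun x y => ?_, fun i y => ?_⟩, fun x hx => ?_⟩
  · by_cases h : x = y
    · rw [h, d_self, d_self]
    · exact d_ne _ _ h
  · rintro ⟨θ, hθ, h⟩
    exact M.P_sym i θ hθ x ((Q_ι i (x ∘ θ)).1 h)
  · exact fun h => ⟨1, one_mem _, (Q_ι i x).2 h⟩
  · change d _ _ = d _ _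
    by_cases h : x.1 = y.1
    · have : (σ x).2 = (σ y).2 ↔ x.2 = y.2 := by
        constructor
        · intro e
          refine funext fun i => funext fun t => ?_
          have := congrFun (congrFun e i) (π ∘ t)
          simp only [σ, symm_comp, h] at this
          exact add_right_cancel this
        · intro e
          simp only [σ, h, e]
      simp only [d, this]
      rw [show (σ x).1 = π x.1 from rfl, show (σ y).1 = π y.1 from rfl, hπ]
    · rw [d_ne _ _ h, d_ne (σ x) (σ y) (π.injective.ne h)]
      exact hπ _ _
  · exact exists_congr fun θ => and_congr_right fun _ => Q_σ i (y ∘ θ)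
  · refine Prod.ext rfl (funext fun i => funext fun s => ?_)
    obtain ⟨t, rfl⟩ : ∃ t, π ∘ t = s := ⟨π.symm ∘ s, funext fun j => π.apply_symm_apply _⟩
    simp only [σ, ι, symm_comp, χ, φ, Function.comp_apply, EmbeddingLike.apply_eq_iff_eq]
    by_cases h : ∃ j, t j ∉ dom
    · have ho : t (o i t) ≠ x := fun e => by
        have := h.choose_spec
        simp only [o, dif_pos h] at e
        exact this (e ▸ hx)
      rw [if_neg ho]
      split_ifs <;> simp [c]
    · have hc : c i t = 0 := by
        push Not at h
        simp only [c, ind, hP i t h, sub_self]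
      have hc' : ind i (π ∘ t) = ind i t := sub_eq_zero.1 hc
      rw [hc, hc']
      simp

/-- A partial automorphism of a finite structure extends to an automorphism of a finite
extension. -/
theorem exists_automorphism_extension {X : Type u} [Finite X] (M : UMetric D X) (dom : Set X)
    (p : X → X) (hp : ∀ x ∈ dom, ∀ y ∈ dom, M.d (p x) (p y) = M.d x y)
    (hP : ∀ i x, (∀ j, x j ∈ dom) → (M.P i (p ∘ x) ↔ M.P i x)) :
    ∃ (Y : Type u) (_ : Finite Y) (N : UMetric D Y) (ι : X → Y) (σ : Y → Y),
      IsEmb M N ι ∧ IsEmb N N σ ∧ ∀ x ∈ dom, σ (ι x) = ι (p x) := by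
  obtain ⟨Y, _, N, ι, π, hι, hπ, hπι⟩ := M.exists_isometry_extension dom p hp
  obtain ⟨Z, hZ, O, κ, σ, hκ, hσ, hσκ⟩ := N.exists_relation_extension (ι '' dom) π hπ
    fun i y hy => by
      choose x hx hxy using hy
      obtain rfl : ι ∘ x = y := funext hxy
      have : π ∘ ι ∘ x = ι ∘ p ∘ x := funext fun j => hπι _ (hx j)
      rw [this, hι.P_map, hι.P_map, hP i x hx]
  refine ⟨Z, hZ, O, κ ∘ ι, σ, hκ.comp hι, hσ, fun x hx => ?_⟩
  rw [Function.comp_apply, Function.comp_apply, hσκ _ ⟨x, hx, rfl⟩, hπι x hx]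

end UMetric

end UltrametricData

/-! ### Translation between structures in the language and ultrametrics -/

namespace UltrametricData

open FirstOrder FirstOrder.Language

section Structures

variable {D : UltrametricData}

/-- The nonzero distance given by an element of `S`. -/
def radius (s : D.S) : D.Radius := ⟨s, Or.inl s.2⟩

theorem exists_radius_eq (h : D.S.Nonempty) {r : WithBot D.Radius} (hr : r ≠ ⊥) :
    ∃ s : D.S, r = radius s := by
  obtain ⟨⟨x, hx⟩, rfl⟩ := WithBot.ne_bot_iff_exists.1 hr
  rcases hx with hx | ⟨hx, -⟩
  · exact ⟨⟨x, hx⟩, rfl⟩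
  · exact absurd h (Set.not_nonempty_iff_eq_empty.2 hx)

theorem eq_bot_of_lt (h : D.S = ∅) {r r' : WithBot D.Radius} (hr : r < r') : r = ⊥ := by
  by_contra hne
  obtain ⟨⟨x, hx⟩, rfl⟩ := WithBot.ne_bot_iff_exists.1 hne
  obtain ⟨⟨y, hy⟩, rfl⟩ := WithBot.ne_bot_iff_exists.1 (bot_le.trans_lt hr).ne'
  simp only [h, Set.mem_empty_iff_false, true_and, false_or] at hx hy
  subst hx hy
  exact lt_irrefl _ hr

/-- If `S` is nonempty, every value other than `⊥` is a radius. If `S` is empty there is only one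
such value, and `h₀` decides. -/
theorem le_of_forall_radius {r r' : WithBot D.Radius} (h₀ : r = ⊥ → r' = ⊥)
    (h : ∀ s : D.S, r < radius s → r' < radius s) : r' ≤ r := by
  by_contra hlt
  rw [not_le] at hlt
  rcases D.S.eq_empty_or_nonempty with hS | hS
  · exact (bot_le.trans_lt hlt).ne' (h₀ (eq_bot_of_lt hS hlt))
  · obtain ⟨s, rfl⟩ := exists_radius_eq hS (bot_le.trans_lt hlt).ne'
    exact lt_irrefl _ (h s hlt)

theorem eq_of_forall_radius {r r' : WithBot D.Radius} (h₀ : r = ⊥ ↔ r' = ⊥)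
    (h : ∀ s : D.S, r < radius s ↔ r' < radius s) : r = r' :=
  le_antisymm (le_of_forall_radius h₀.2 fun s => (h s).2) (le_of_forall_radius h₀.1 fun s => (h s).1)

/-- The structure in the language of `D` encoded by an ultrametric with relations. -/
@[reducible]
def UMetric.toStructure {X : Type*} (N : UMetric D X) : D.lang.Structure X where
  funMap f := Empty.elim f
  RelMap r := match r with
    | Rel.E s => fun v => N.d (v 0) (v 1) < radius s
    | Rel.P i => fun v => N.P i v

/-- The structure on `X` is the one encoded by `N`. -/
structure UMetric.Encodes {X : Type*} [D.lang.Structure X] (N : UMetric D X) : Prop where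
  relE_iff : ∀ s x y, relE D X s x y ↔ N.d x y < radius s
  relP_iff : ∀ i x, relP D X i x ↔ N.P i x

theorem UMetric.encodes_toStructure {X : Type*} (N : UMetric D X) :
    @UMetric.Encodes D X N.toStructure N := by
  let _ := N.toStructure
  exact ⟨fun _ _ _ => Iff.rfl, fun _ _ => Iff.rfl⟩

theorem UMetric.Encodes.isUStructure {X : Type*} [D.lang.Structure X] {N : UMetric D X}
    (h : N.Encodes) : IsUStructure D X where
  symmetric i θ hθ x := by rw [h.relP_iff, h.relP_iff, N.P_sym_iff hθ]
  distinct i x hx := N.P_inj i x ((h.relP_iff i x).1 hx)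
  equivalence s := by
    refine ⟨fun x => ?_, fun {x y} hxy => ?_, fun {x y z} hxy hyz => ?_⟩
    · rw [h.relE_iff, N.d_self]
      exact WithBot.bot_lt_coe _
    · rwa [h.relE_iff, N.d_comm, ← h.relE_iff]
    · rw [h.relE_iff] at *
      exact (N.d_ultra x y z).trans_lt (max_lt hxy hyz)
  nested s t hst x y hxy := by
    rw [h.relE_iff] at *
    exact hxy.trans (WithBot.coe_lt_coe.2 hst)
  separated hS x y hxy := by
    obtain ⟨s, hs⟩ := exists_radius_eq hS (mt (N.d_eq_bot x y).1 hxy)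
    refine ⟨s, ?_, fun t ht => ?_⟩
    · change ¬ relE D X s x y
      rw [h.relE_iff, hs]
      exact lt_irrefl _
    · change ¬ relE D X t x y at ht
      rw [h.relE_iff, hs, WithBot.coe_lt_coe, not_lt] at ht
      exact ht

/-- The distance of `x ≠ y` is the greatest `s` for which they are not `E_s`-equivalent. Since this
may be `0 ∈ S`, equal points get the extra value `⊥`; nestedness turns `E_s` into distance less than
`s`. -/
theorem IsUStructure.exists_encodes {X : Type*} [D.lang.Structure X] (h : IsUStructure D X) :
    ∃ N : UMetric D X, N.Encodes := by
  classical
  have key : ∀ x y : X, ∃ r : WithBot D.Radius, (r = ⊥ ↔ x = y) ∧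
      ∀ s, relE D X s x y ↔ r < radius s := fun x y => by
    by_cases hxy : x = y
    · subst hxy
      exact ⟨⊥, by simp, fun s => iff_of_true ((h.equivalence s).refl x) (WithBot.bot_lt_coe _)⟩
    · rcases D.S.eq_empty_or_nonempty with hS | hS
      · obtain ⟨r⟩ : Nonempty D.Radius := inferInstance
        refine ⟨r, iff_of_false WithBot.coe_ne_bot hxy, fun s => ?_⟩
        exact absurd hS (Set.nonempty_of_mem s.2).ne_empty
      · obtain ⟨s, hs, hmax⟩ := h.separated hS x y hxy
        refine ⟨radius s, iff_of_false WithBot.coe_ne_bot hxy, fun t => ⟨fun ht => ?_, fun ht => ?_⟩⟩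
        · rcases lt_trichotomy s t with hst | rfl | hst
          · exact WithBot.coe_lt_coe.2 hst
          · exact absurd ht hs
          · exact absurd (h.nested t s hst x y ht) hs
        · by_contra hn
          exact absurd (WithBot.coe_lt_coe.1 ht) (not_lt_of_ge (hmax hn))
  choose d hd₀ hd using key
  refine ⟨⟨d, fun i x => relP D X i x, hd₀, fun x y => ?_, fun x y z => ?_,
    fun i θ hθ x hx => (h.symmetric i θ hθ x).1 hx, h.distinct⟩, fun s x y => hd x y s, fun _ _ => Iff.rfl⟩
  · refine eq_of_forall_radius (by rw [hd₀, hd₀, eq_comm]) fun s => ?_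
    rw [← hd, ← hd]
    exact ⟨(h.equivalence s).symm, (h.equivalence s).symm⟩
  · refine le_of_forall_radius (fun hb => ?_) fun s hs => ?_
    · rw [max_eq_bot, hd₀, hd₀] at hb
      exact (hd₀ x z).2 (hb.1.trans hb.2)
    · rw [max_lt_iff, ← hd, ← hd] at hs
      exact (hd x z s).1 ((h.equivalence s).trans hs.1 hs.2)

section Maps

variable {X : Type*} {Y : Type*} [D.lang.Structure X] [D.lang.Structure Y]

theorem relE_map (f : X ↪[D.lang] Y) (s : D.S) (x y : X) :
    relE D Y s (f x) (f y) ↔ relE D X s x y := by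
  have h := f.map_rel (Rel.E s : D.lang.Relations 2) ![x, y]
  have e : f ∘ ![x, y] = ![f x, f y] := by
    funext i
    fin_cases i <;> rfl
  rwa [e] at h

theorem relP_map (f : X ↪[D.lang] Y) (i : Fin D.r) (x : Fin (D.arity i) → X) :
    relP D Y i (f ∘ x) ↔ relP D X i x :=
  f.map_rel (Rel.P i : D.lang.Relations (D.arity i)) x

theorem UMetric.Encodes.isEmb {M : UMetric D X} {N : UMetric D Y} (hM : M.Encodes)
    (hN : N.Encodes) (f : X ↪[D.lang] Y) : UMetric.IsEmb M N f := by
  refine ⟨fun x y => eq_of_forall_radius ?_ fun s => ?_, fun i x => ?_⟩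
  · rw [N.d_eq_bot, M.d_eq_bot, f.injective.eq_iff]
  · rw [← hN.relE_iff, ← hM.relE_iff, relE_map]
  · rw [← hN.relP_iff, ← hM.relP_iff, relP_map]

theorem UMetric.Encodes.exists_embedding {M : UMetric D X} {N : UMetric D Y} (hM : M.Encodes)
    (hN : N.Encodes) {f : X → Y} (hf : UMetric.IsEmb M N f) :
    ∃ g : X ↪[D.lang] Y, ∀ x, g x = f x := by
  refine ⟨⟨⟨f, hf.injective⟩, fun {n} k => Empty.elim k, fun {n} r v => ?_⟩, fun _ => rfl⟩
  cases r with
  | E s =>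
    obtain ⟨x, y, rfl⟩ : ∃ x y, v = ![x, y] :=
      ⟨v 0, v 1, funext fun i => by fin_cases i <;> rfl⟩
    have e : f ∘ ![x, y] = ![f x, f y] := funext fun i => by fin_cases i <;> rfl
    have h := hN.relE_iff s (f x) (f y)
    rw [hf.d_map, ← hM.relE_iff, relE, ← e] at h
    exact h
  | P i => exact (hN.relP_iff i _).trans ((hf.P_map i v).trans (hM.relP_iff i v).symm)

end Maps

end Structures

/-! ### The two extension properties for the randomised ultrametric space -/

namespace IsRandomisedUltrametricSpace

variable {D : UltrametricData} {U : Type u} [D.lang.Structure U] [Countable U]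

/-- Each axiom concerns finitely many points at a time, and these lie in a finitely generated
substructure, which belongs to the age. -/
theorem isUStructure (hU : D.IsRandomisedUltrametricSpace U) : IsUStructure D U := by
  classical
  have key : ∀ F : Finset U, ∃ (X : Type u) (_ : D.lang.Structure X) (f : X ↪[D.lang] U),
      IsUStructure D X ∧ ∀ x ∈ F, x ∈ Set.range f := fun F => by
    have hmem := age.fg_substructure (L := D.lang)
      (Substructure.fg_closure (L := D.lang) F.finite_toSet)
    rw [hU.age] at hmem
    exact ⟨_, inferInstance, Substructure.subtype _, hmem.2, fun x hx =>
      ⟨⟨x, Substructure.subset_closure hx⟩, rfl⟩⟩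
  have tuple : ∀ {n : ℕ} (x : Fin n → U), ∃ (X : Type u) (_ : D.lang.Structure X)
      (f : X ↪[D.lang] U) (y : Fin n → X), IsUStructure D X ∧ f ∘ y = x := fun x => by
    obtain ⟨X, _, f, hX, h⟩ := key (Finset.univ.image x)
    choose y hy using fun i => h (x i) (by simp)
    exact ⟨X, _, f, y, hX, funext hy⟩
  refine ⟨fun i θ hθ x => ?_, fun i x hx => ?_, fun s => ⟨fun x => ?_, fun {x y} hxy => ?_,
    fun {x y z} hxy hyz => ?_⟩, fun s t hst x y hxy => ?_, fun hS x y hxy => ?_⟩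
  · obtain ⟨X, _, f, y, hX, rfl⟩ := tuple x
    rw [Function.comp_assoc, relP_map, relP_map, hX.symmetric i θ hθ]
  · obtain ⟨X, _, f, y, hX, rfl⟩ := tuple x
    rw [relP_map] at hx
    exact f.injective.comp (hX.distinct i y hx)
  · obtain ⟨X, _, f, hX, h⟩ := key {x}
    obtain ⟨a, rfl⟩ := h x (by simp)
    rw [relE_map]
    exact (hX.equivalence s).refl a
  · obtain ⟨X, _, f, hX, h⟩ := key {x, y}
    obtain ⟨a, rfl⟩ := h x (by simp)
    obtain ⟨b, rfl⟩ := h y (by simp)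
    rw [relE_map] at *
    exact (hX.equivalence s).symm hxy
  · obtain ⟨X, _, f, hX, h⟩ := key {x, y, z}
    obtain ⟨a, rfl⟩ := h x (by simp)
    obtain ⟨b, rfl⟩ := h y (by simp)
    obtain ⟨c, rfl⟩ := h z (by simp)
    rw [relE_map] at *
    exact (hX.equivalence s).trans hxy hyz
  · obtain ⟨X, _, f, hX, h⟩ := key {x, y}
    obtain ⟨a, rfl⟩ := h x (by simp)
    obtain ⟨b, rfl⟩ := h y (by simp)
    rw [relE_map] at *
    exact hX.nested s t hst a b hxy
  · obtain ⟨X, _, f, hX, h⟩ := key {x, y}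
    obtain ⟨a, rfl⟩ := h x (by simp)
    obtain ⟨b, rfl⟩ := h y (by simp)
    simp only [relE_map]
    exact hX.separated hS a b fun e => hxy (congrArg f e)

variable {M : UMetric D U}

theorem exists_isEmb (hU : D.IsRandomisedUltrametricSpace U) (hM : M.Encodes) {B : Type u}
    [Finite B] (N : UMetric D B) : ∃ j : B → U, UMetric.IsEmb N M j := by
  let _ := N.toStructure
  have hmem : (CategoryTheory.Bundled.mk B : CategoryTheory.Bundled D.lang.Structure) ∈
      D.lang.age U := by
    rw [hU.age]
    exact ⟨‹Finite B›, N.encodes_toStructure.isUStructure⟩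
  obtain ⟨f⟩ := hmem.2
  exact ⟨f, N.encodes_toStructure.isEmb hM f⟩

/-- Ultrahomogeneity, stated for two embeddings of one finite ultrametric instead of a map defined
on a substructure. -/
theorem exists_aut (hU : D.IsRandomisedUltrametricSpace U) (hM : M.Encodes) {B : Type u}
    [Finite B] {N : UMetric D B} {j k : B → U} (hj : UMetric.IsEmb N M j)
    (hk : UMetric.IsEmb N M k) : ∃ g : U ≃[D.lang] U, ∀ b, g (j b) = k b := by
  let _ := N.toStructure
  obtain ⟨e, he⟩ := N.encodes_toStructure.exists_embedding hM hj
  obtain ⟨e', he'⟩ := N.encodes_toStructure.exists_embedding hM hk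
  have hfin : Finite e.toHom.range := Finite.of_equiv B e.equivRange.toEquiv
  obtain ⟨g, hg⟩ := hU.ultrahomogeneous e.toHom.range Substructure.FG.of_finite
    (e'.comp e.equivRange.symm.toEmbedding)
  refine ⟨g, fun b => ?_⟩
  have h : e' (e.equivRange.symm (e.equivRange b)) = g (e b) :=
    DFunLike.congr_fun hg (e.equivRange b)
  rw [← he, ← he', ← h, e.equivRange.symm_apply_apply]

theorem hasFiniteExtensions (hU : D.IsRandomisedUltrametricSpace U) :
    FirstOrder.Language.Equiv.HasFiniteExtensions D.lang U := by
  classical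
  obtain ⟨M, hM⟩ := hU.isUStructure.exists_encodes
  intro F g
  let A : Finset U := F ∪ F.image g
  have hg := hM.isEmb hM g.toEmbedding
  -- Outside `F` the value is an arbitrary default; only `F` is the domain of the partial
  -- automorphism.
  let p : A → A := fun x => if h : (x : U) ∈ F then
    ⟨g x, Finset.mem_union_right _ (Finset.mem_image_of_mem _ h)⟩ else x
  have hp : ∀ x : A, (x : U) ∈ F → (p x : U) = g x := fun x hx => by simp only [p, dif_pos hx]
  obtain ⟨Y, _, N, ι, σ, hι, hσ, hισ⟩ := (M.restrict A).exists_automorphism_extension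
    {x | (x : U) ∈ F} p
    (fun x hx y hy => by
      change M.d (p x) (p y) = M.d x y
      rw [hp x hx, hp y hy]
      exact hg.d_map x y)
    (fun i x hx => by
      change M.P i (Subtype.val ∘ p ∘ x) ↔ M.P i (Subtype.val ∘ x)
      have : Subtype.val ∘ p ∘ x = g ∘ Subtype.val ∘ x := funext fun j => hp _ (hx j)
      rw [this]
      exact hg.P_map i _)
  obtain ⟨j₀, hj₀⟩ := hU.exists_isEmb hM N
  -- The finite extension is embedded somewhere in `U`; `k` moves it so that its copy of `A` is `A`
  -- itself.
  obtain ⟨k, hk⟩ := hU.exists_aut hM (hj₀.comp hι) (M.isEmb_comap Subtype.val _)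
  have hj : UMetric.IsEmb N M (k ∘ j₀) := (hM.isEmb hM k.toEmbedding).comp hj₀
  obtain ⟨g', hg'⟩ := hU.exists_aut hM hj (hj.comp hσ)
  have := Fintype.ofFinite Y
  have hFA : ∀ x ∈ F, x ∈ A := fun x hx => Finset.mem_union_left _ hx
  refine ⟨g', Finset.univ.image (k ∘ j₀), fun x hx => ?_, fun x hx => ?_,
    Equiv.Inv.of_forall g'.injective fun y hy => ?_⟩
  · have h1 := hg' (ι ⟨x, hFA x hx⟩)
    rw [Function.comp_apply, Function.comp_apply (f := k ∘ j₀), hισ _ hx] at h1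
    exact ((congrArg g' (hk ⟨x, hFA x hx⟩)).symm.trans h1).trans ((hk _).trans (hp _ hx))
  · exact Finset.mem_image.2 ⟨ι ⟨x, hFA x hx⟩, Finset.mem_univ _, hk _⟩
  · obtain ⟨y, -, rfl⟩ := Finset.mem_image.1 hy
    rw [hg']
    exact Finset.mem_image_of_mem _ (Finset.mem_univ _)

theorem hasEquivariantAmalgams (hU : D.IsRandomisedUltrametricSpace U) :
    FirstOrder.Language.Equiv.HasEquivariantAmalgams D.lang U := by
  obtain ⟨M, hM⟩ := hU.isUStructure.exists_encodes
  intro n π A B β hπ hAB hB hA hβA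
  obtain ⟨Y, _, N, κ, δ, hκ, hκA, hδ, hδκ⟩ := M.exists_amalgam hπ hAB
    (β := fun i => β i) (fun i => hM.isEmb hM (β i).toEmbedding) (fun i => (β i).surjective)
    hB hA hβA
  obtain ⟨j, hj⟩ := hU.exists_isEmb hM N
  -- Once the amalgam is embedded in `U`, homogeneity realises its automorphism `δ` by `g` and the
  -- embedding of each `B i` by `f i`.
  obtain ⟨g, hg⟩ := hU.exists_aut hM hj (hj.comp hδ)
  choose f hf using fun i => hU.exists_aut hM (M.isEmb_comap Subtype.val _) (hj.comp (hκ i))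
  have hf' : ∀ i b (hb : b ∈ B i), f i b = j (κ i ⟨b, hb⟩) := fun i b hb => hf i ⟨b, hb⟩
  refine ⟨g, f, fun i i' a ha => ?_, fun i b hb => ?_⟩
  · rw [hf' i a (hAB i ha), hf' i' a (hAB i' ha), hκA i i' a ha]
  · rw [hf' i b hb, hg, Function.comp_apply, hδκ i b hb, hf' (π i) (β i b) ((hB i b).2 hb)]

end IsRandomisedUltrametricSpace

end UltrametricData

theorem mainTheorem6 (D : UltrametricData) (U : Type*) [D.lang.Structure U] [Countable U]
    (hU : D.IsRandomisedUltrametricSpace U) :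
    (∃ g : U ≃[D.lang] U, IsGenericAut g) ∧
      ∀ g : U ≃[D.lang] U, IsGenericAut g →
        (∀ n : ℕ, 1 ≤ n → ∃ h : U ≃[D.lang] U, h ^ n = g) ∧
        (∀ n : ℤ, n ≠ 0 → IsConj g (g ^ n)) :=
  FirstOrder.Language.Equiv.exists_generic_and_conj_zpow hU.hasFiniteExtensions
    hU.hasEquivariantAmalgams
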